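/- Throughout, $\log=\log_2$. Let $\mathcal H$ be a finite-dimensional complex Hilbert space and let $\rho,\sigma$ be density operators on $\mathcal H$ (positive semidefinite operators of unit trace) with $\operatorname{supp}\rho\subseteq\operatorname{supp}\sigma$. For density operators $\omega,\tau$ let $F(\omega,\tau)=\operatorname{Tr}\sqrt{\sqrt\omega\,\tau\sqrt\omega}$ be the fidelity and $d_{\mathrm{op}}(\omega,\tau)=\sqrt{1-F(\omega,\tau)^2}$. For positive semidefinite operators let $D_{\max}(\omega\|\tau)=\inf\{\gamma\in\mathbb R:\ \omega\le 2^{\gamma}\tau\}$ (with value $+\infty$ if there is no such $\gamma$), and for a density operator $\omega$ let $$D^{\varepsilon}_{\max}(\omega\|\tau)=\min\{D_{\max}(\bar\omega\|\tau):\ \bar\omega\ge 0,\ \operatorname{Tr}\bar\omega=1,\ d_{\mathrm{op}}(\bar\omega,\omega)\le\varepsilon\}.$$ Let $D(\rho\|\sigma)=\operatorname{Tr}\rho(\log\rho-\log\sigma)$ be the relative entropy and $$\eta=1+\operatorname{Tr}\rho^{3/2}\sigma^{-1/2}+\operatorname{Tr}\rho^{1/2}\sigma^{1/2},$$ where logarithms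 and negative powers of operators are taken on their supports. Then for all real $0<\varepsilon<\varepsilon'<1$ and every integer $n\ge 1$, $$\frac1n D^{\varepsilon}_{\max}\left(\rho^{\otimes n}\|\sigma^{\otimes n}\right)\le D(\rho\|\sigma)+\frac{1}{\sqrt n}\,4\sqrt2\,(\log\eta)\,\log\left(1-\sqrt{1-\varepsilon^2}\right)^{-1},$$ $$\frac1n D^{\varepsilon}_{\max}\left(\rho^{\otimes n}\|\sigma^{\otimes n}\right)\ge D(\rho\|\sigma)-\frac{1}{\sqrt n}\,4\sqrt2\,(\log\eta)\,\log(1-\varepsilon')^{-1}-\frac1n\log\frac{1}{\varepsilon'-\varepsilon}.$$ (Here $\log x^{-1}$ means $\log(x^{-1})$.) In particular, for every $\varepsilon\in(0,1)$, $$\lim_{n\to\infty}\frac1n D^{\varepsilon}_{\max}\left(\rho^{\otimes n}\|\sigma^{\otimes n}\right)=D(\rho\|\sigma).$$ -/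

import Mathlib

open Filter Topology
open scoped ComplexOrder MatrixOrder

noncomputable section

namespace QAEP

/-! Operators on a finite-dimensional complex Hilbert space are complex square matrices indexed by
a finite type `ι` (an orthonormal basis); `A ≤ B` is the Loewner order, i.e. `B - A` is positive
semidefinite. Functions of Hermitian matrices are given by the continuous functional calculus.
All logarithms are to base `2`. -/

variable {ι : Type*} [Fintype ι] [DecidableEq ι]

/-- Density matrices: positive semidefinite operators of unit trace. -/
def IsState (ρ : Matrix ι ι ℂ) : Prop :=
  ρ.PosSemidef ∧ ρ.trace = 1

/-- The support of a positive semidefinite operator, i.e. the orthogonal complement of its kernel,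
which is its range. -/
def supp (A : Matrix ι ι ℂ) : Submodule ℂ (ι → ℂ) :=
  LinearMap.range A.mulVecLin

/-- The binary logarithm of a positive semidefinite operator, taken on its support
(`Real.logb 2 0 = 0`). -/
def matLog (A : Matrix ι ι ℂ) : Matrix ι ι ℂ :=
  cfc (Real.logb 2) A

open Classical in
/-- The relative entropy `D(ρ‖σ) = Tr ρ (log ρ - log σ)` if `supp ρ ⊆ supp σ`, and `+∞` otherwise.
-/
def relEntropy (ρ σ : Matrix ι ι ℂ) : EReal :=
  if supp ρ ≤ supp σ then (((ρ * (matLog ρ - matLog σ)).trace.re : ℝ) : EReal) else ⊤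

/-- The fidelity `F(ρ, σ) = Tr √(√ρ σ √ρ)`. -/
def fidelity (ρ σ : Matrix ι ι ℂ) : ℝ :=
  (CFC.sqrt (CFC.sqrt ρ * σ * CFC.sqrt ρ)).trace.re

/-- The distance of optimal purifications `√((Tr ρ + Tr σ)² / 4 - F(ρ, σ)²)`; it is the sine
distance `√(1 - F(ρ, σ)²)` if `ρ` and `σ` are states. -/
def dOp (ρ σ : Matrix ι ι ℂ) : ℝ :=
  Real.sqrt ((ρ.trace.re + σ.trace.re) ^ 2 / 4 - fidelity ρ σ ^ 2)

/-- The `ε`-ball of states around `ρ`. -/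
def ball (ε : ℝ) (ρ : Matrix ι ι ℂ) : Set (Matrix ι ι ℂ) :=
  {ω | IsState ω ∧ dOp ω ρ ≤ ε}

/-- The max-relative entropy `inf {γ : ρ ≤ 2 ^ γ σ}`, with value `+∞` if there is no such real
number `γ`. -/
def dMax (ρ σ : Matrix ι ι ℂ) : EReal :=
  ⨅ (γ : ℝ) (_ : ρ ≤ ((2 : ℝ) ^ γ) • σ), (γ : EReal)

/-- The `ε`-smooth max-relative entropy: the smallest value of `dMax ω σ` over the states `ω` of
the `ε`-ball around `ρ`. -/
def dMaxSmooth (ε : ℝ) (ρ σ : Matrix ι ι ℂ) : EReal :=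
  ⨅ ω ∈ ball ε ρ, dMax ω σ

/-- The `n`-fold tensor power of an operator, on the space with the product basis. -/
def tensorPow (A : Matrix ι ι ℂ) (n : ℕ) : Matrix (Fin n → ι) (Fin n → ι) ℂ :=
  Matrix.of fun i j => ∏ k, A (i k) (j k)

/-- `η = 1 + Tr ρ^{3/2} σ^{-1/2} + Tr ρ^{1/2} σ^{1/2}`. The powers are those of the functional
calculus, with `0 ^ s = 0` for `s ≠ 0`: the negative power is taken on the support. -/
def eta (ρ σ : Matrix ι ι ℂ) : ℝ :=
  1 + (ρ ^ (3 / 2 : ℝ) * σ ^ (-1 / 2 : ℝ)).trace.re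
    + (ρ ^ (1 / 2 : ℝ) * σ ^ (1 / 2 : ℝ)).trace.re

end QAEP

end

/-! Diagonalise `ρ = V diag(r) V*` and `σ = W diag(s) W*`. The weights `pᵢⱼ = rᵢ |⟨vᵢ, wⱼ⟩|²` form a
probability distribution, under which the log-likelihood ratio `Xᵢⱼ = log rᵢ - log sⱼ` has mean
`D(ρ‖σ) log 2` and `η = 1 + E[2 cosh (X / 2)]`. The smooth max-relative entropy is governed by the
distribution function of `X` up to a change of threshold. For the upper bound, capping the
likelihood ratio by a Schur multiplier with entries `min a b / √(a b)` moves `ρ` to a nearby state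
of small max-relative entropy; for the lower bound, `ω ≤ 2 ^ γ σ` bounds the fidelity of `ω` with
`ρ` by the probability that `X` is small.

For `n` copies the centred `X` becomes a sum of `n` independent centred copies, whose moments are
controlled at the scale `√n log η`. The fluctuations at a fixed error are therefore of order `√n`,
with a factor logarithmic in the error, because a centred variable whose distribution function stays
small on `[0, T]` would need too large a negative part. -/

noncomputable section

namespace QAEP

open Matrix

/-! ### Tensor powers -/

section TensorPow

variable {ι : Type*}

lemma tensorPow_mul [Fintype ι] (A B : Matrix ι ι ℂ) (n : ℕ) :
    tensorPow (A * B) n = tensorPow A n * tensorPow B n := by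
  ext I J
  simp only [tensorPow, of_apply, Matrix.mul_apply, ← Finset.prod_mul_distrib,
    Finset.prod_univ_sum, Fintype.piFinset_univ]

lemma tensorPow_star (A : Matrix ι ι ℂ) (n : ℕ) :
    tensorPow (star A) n = star (tensorPow A n) := by
  ext I J
  simp only [tensorPow, of_apply, star_apply, star_prod]

lemma tensorPow_diagonal [DecidableEq ι] (f : ι → ℂ) (n : ℕ) :
    tensorPow (diagonal f) n = diagonal (fun I : Fin n → ι => ∏ k, f (I k)) := by
  ext I J
  simp only [tensorPow, of_apply, diagonal_apply, Finset.prod_ite_zero, Finset.mem_univ,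
    forall_const, funext_iff]

lemma tensorPow_one [DecidableEq ι] (n : ℕ) : tensorPow (1 : Matrix ι ι ℂ) n = 1 := by
  simp only [← diagonal_one, tensorPow_diagonal, Finset.prod_const_one]

end TensorPow

variable {ι : Type*} [Fintype ι] [DecidableEq ι]

/-! ### Operators diagonal in a given orthonormal basis -/

/-- The operator `V diag(r) V*` with eigenvalues `r` in the orthonormal basis formed by the columns
of `V`, as a homomorphism of star algebras in `r`. -/
def diagIn (V : unitaryGroup ι ℂ) : (ι → ℝ) →⋆ₐ[ℝ] Matrix ι ι ℂ where
  toFun r := V * diagonal (fun i => (r i : ℂ)) * star (V : Matrix ι ι ℂ)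
  map_one' := by simp
  map_mul' r t := by
    rw [show diagonal (fun i => ((r * t) i : ℂ)) = diagonal (fun i => (r i : ℂ)) *
      (star (V : Matrix ι ι ℂ) * V) * diagonal (fun i => (t i : ℂ)) by simp]
    simp only [Matrix.mul_assoc]
  map_zero' := by simp
  map_add' r t := by
    rw [← Matrix.add_mul, ← Matrix.mul_add, diagonal_add]
    simp
  commutes' c := by
    have h : diagonal (fun i => ((algebraMap ℝ (ι → ℝ) c i : ℝ) : ℂ)) = c • 1 := by
      ext i j
      by_cases hij : i = j <;> simp [hij]
    rw [h, Matrix.mul_smul, Matrix.smul_mul, Matrix.mul_one, Unitary.mul_star_self_of_mem V.2,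
      Algebra.algebraMap_eq_smul_one]
  map_star' r := by
    simp only [star_eq_conjTranspose, conjTranspose_mul, conjTranspose_conjTranspose,
      diagonal_conjTranspose, Matrix.mul_assoc]
    congr 3
    ext i
    simp

lemma diagIn_apply (V : unitaryGroup ι ℂ) (r : ι → ℝ) :
    diagIn V r = V * diagonal (fun i => (r i : ℂ)) * star (V : Matrix ι ι ℂ) := rfl

lemma isHermitian_diagIn (V : unitaryGroup ι ℂ) (r : ι → ℝ) : (diagIn V r).IsHermitian := by
  rw [IsHermitian, ← star_eq_conjTranspose, ← map_star, star_trivial]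

lemma posSemidef_diagIn_iff {V : unitaryGroup ι ℂ} {r : ι → ℝ} :
    (diagIn V r).PosSemidef ↔ 0 ≤ r := by
  rw [diagIn_apply, Unitary.isUnit_coe.posSemidef_star_right_conjugate_iff,
    posSemidef_diagonal_iff, Pi.le_def]
  simp only [Complex.zero_le_real, Pi.zero_apply]

lemma trace_diagIn (V : unitaryGroup ι ℂ) (r : ι → ℝ) :
    (diagIn V r).trace = ((∑ i, r i : ℝ) : ℂ) := by
  rw [diagIn_apply, trace_mul_comm, ← Matrix.mul_assoc, Unitary.coe_star_mul_self,
    Matrix.one_mul, trace_diagonal, Complex.ofReal_sum]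

lemma isState_diagIn_iff {V : unitaryGroup ι ℂ} {r : ι → ℝ} :
    IsState (diagIn V r) ↔ 0 ≤ r ∧ ∑ i, r i = 1 := by
  rw [IsState, posSemidef_diagIn_iff, trace_diagIn, Complex.ofReal_eq_one]

lemma exists_eq_diagIn {A : Matrix ι ι ℂ} (hA : A.IsHermitian) :
    ∃ (V : unitaryGroup ι ℂ) (r : ι → ℝ), diagIn V r = A :=
  ⟨hA.eigenvectorUnitary, hA.eigenvalues, hA.spectral_theorem.symm⟩

lemma spectrum_diagIn_subset (V : unitaryGroup ι ℂ) (r : ι → ℝ) :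
    spectrum ℝ (diagIn V r) ⊆ Set.range r := by
  refine (AlgHom.spectrum_apply_subset (diagIn V) r).trans ?_
  rw [Pi.spectrum_eq, Set.iUnion_subset_iff]
  rintro i x hx
  exact ⟨i, (by simpa [spectrum.mem_iff, sub_eq_zero, eq_comm] using hx)⟩

lemma cfc_diagIn (V : unitaryGroup ι ℂ) (r : ι → ℝ) (f : ℝ → ℝ) :
    cfc f (diagIn V r) = diagIn V (f ∘ r) := by
  let p := Lagrange.interpolate (Finset.univ.image r) id f
  have hp : ∀ i, p.eval (r i) = f (r i) := fun i =>
    Lagrange.eval_interpolate_at_node f Function.injective_id.injOn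
      (Finset.mem_image_of_mem r (Finset.mem_univ i))
  have hfp : (spectrum ℝ (diagIn V r)).EqOn f (p.eval ·) := by
    intro x hx
    obtain ⟨i, rfl⟩ := spectrum_diagIn_subset V r hx
    exact (hp i).symm
  rw [cfc_congr hfp, cfc_polynomial p _ (isHermitian_diagIn V r).isSelfAdjoint,
    Polynomial.aeval_algHom_apply]
  exact congrArg (diagIn V) (funext fun i => by
    rw [Polynomial.aeval_pi_apply₂, Polynomial.coe_aeval_eq_eval, hp, Function.comp_apply])

lemma sqrt_diagIn (V : unitaryGroup ι ℂ) {r : ι → ℝ} (hr : 0 ≤ r) :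
    CFC.sqrt (diagIn V r) = diagIn V (Real.sqrt ∘ r) := by
  rw [CFC.sqrt_eq_real_sqrt _ (posSemidef_diagIn_iff.mpr hr).nonneg, cfcₙ_eq_cfc, cfc_diagIn]

lemma rpow_diagIn (V : unitaryGroup ι ℂ) {r : ι → ℝ} (hr : 0 ≤ r) (s : ℝ) :
    diagIn V r ^ s = diagIn V (fun i => r i ^ s) := by
  rw [CFC.rpow_eq_cfc_real (ha := (posSemidef_diagIn_iff.mpr hr).nonneg), cfc_diagIn]
  rfl

/-- The transition probabilities `|⟨vᵢ, wⱼ⟩|²` between the orthonormal bases formed by the columns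
of `V` and of `W`. -/
def overlap (V W : unitaryGroup ι ℂ) (i j : ι) : ℝ :=
  Complex.normSq ((star (V : Matrix ι ι ℂ) * W) i j)

lemma overlap_nonneg (V W : unitaryGroup ι ℂ) (i j : ι) : 0 ≤ overlap V W i j :=
  Complex.normSq_nonneg _

lemma trace_diagIn_mul_mul_diagIn (V W : unitaryGroup ι ℂ) (f g : ι → ℝ) (G : Matrix ι ι ℂ) :
    (diagIn W g * G * diagIn V f).trace = ∑ i, ∑ j, (f i : ℂ) * g j *
      ((star (W : Matrix ι ι ℂ) * G * V) j i * (star (V : Matrix ι ι ℂ) * W) i j) := by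
  have htrace : (diagIn W g * G * diagIn V f).trace
      = (diagonal (fun j => (g j : ℂ)) * (star (W : Matrix ι ι ℂ) * G * V)
        * (diagonal (fun i => (f i : ℂ)) * (star (V : Matrix ι ι ℂ) * W))).trace := by
    simp only [diagIn_apply, Matrix.mul_assoc]
    rw [trace_mul_comm (W : Matrix ι ι ℂ)]
    simp only [Matrix.mul_assoc]
  rw [htrace, trace, Finset.sum_comm]
  refine Finset.sum_congr rfl fun j _ => ?_
  rw [diag_apply, mul_apply]
  refine Finset.sum_congr rfl fun i _ => ?_
  rw [diagonal_mul, diagonal_mul]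
  ring

lemma trace_diagIn_mul_diagIn (V W : unitaryGroup ι ℂ) (f g : ι → ℝ) :
    (diagIn V f * diagIn W g).trace.re = ∑ i, ∑ j, f i * g j * overlap V W i j := by
  rw [trace_mul_comm, ← Matrix.mul_one (diagIn W g), trace_diagIn_mul_mul_diagIn]
  simp only [Complex.re_sum]
  refine Finset.sum_congr rfl fun i _ => Finset.sum_congr rfl fun j _ => ?_
  have hconj : (star (W : Matrix ι ι ℂ) * V) j i
      = starRingEnd ℂ ((star (V : Matrix ι ι ℂ) * W) i j) := by
    rw [← Complex.star_def, ← star_apply, star_mul, star_star]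
  rw [Matrix.mul_one, hconj, ← Complex.normSq_eq_conj_mul_self, ← Complex.ofReal_mul,
    ← Complex.ofReal_mul, Complex.ofReal_re, overlap]

lemma sum_overlap_right (V W : unitaryGroup ι ℂ) (i : ι) : ∑ j, overlap V W i j = 1 := by
  have h := trace_diagIn_mul_diagIn V W (Pi.single i 1) 1
  rw [map_one, Matrix.mul_one, trace_diagIn] at h
  simpa [Pi.single_apply] using h.symm

lemma sum_overlap_left (V W : unitaryGroup ι ℂ) (j : ι) : ∑ i, overlap V W i j = 1 := by
  have h := trace_diagIn_mul_diagIn V W 1 (Pi.single j 1)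
  rw [map_one, Matrix.one_mul, trace_diagIn] at h
  simpa [Pi.single_apply] using h.symm

/-- The product basis of an orthonormal basis. -/
def tensorPowUnitary (V : unitaryGroup ι ℂ) (n : ℕ) : unitaryGroup (Fin n → ι) ℂ :=
  ⟨tensorPow V n, mem_unitaryGroup_iff.mpr <| by
    rw [← tensorPow_star, ← tensorPow_mul, Unitary.mul_star_self_of_mem V.2, tensorPow_one]⟩

lemma tensorPow_diagIn (V : unitaryGroup ι ℂ) (r : ι → ℝ) (n : ℕ) :
    tensorPow (diagIn V r) n = diagIn (tensorPowUnitary V n) (fun I => ∏ k, r (I k)) := by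
  simp only [diagIn_apply, tensorPow_mul, tensorPow_star, tensorPow_diagonal, tensorPowUnitary,
    Complex.ofReal_prod]

lemma overlap_tensorPowUnitary (V W : unitaryGroup ι ℂ) (n : ℕ) (I J : Fin n → ι) :
    overlap (tensorPowUnitary V n) (tensorPowUnitary W n) I J
      = ∏ k, overlap V W (I k) (J k) := by
  simp only [overlap, tensorPowUnitary, ← tensorPow_star, ← tensorPow_mul, ← map_prod]
  rfl

/-! ### Contractions -/

lemma mul_mul_star_le_of_contraction {R : Type*} [Semiring R] [PartialOrder R] [StarRing R]
    [StarOrderedRing R] (b : R) {g : R} (hg : g * star g ≤ 1) :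
    b * g * star (b * g) ≤ b * star b := by
  have h := star_right_conjugate_le_conjugate hg b
  rwa [mul_one, ← mul_assoc, mul_assoc, ← star_mul] at h

section Contraction

variable {n 𝕜 : Type*} [Fintype n] [DecidableEq n] [RCLike 𝕜] {A K P T : Matrix n n 𝕜}

lemma posSemidef_fromBlocks_iff_star_mul_self_le_one :
    (fromBlocks 1 K (star K) 1).PosSemidef ↔ star K * K ≤ 1 := by
  let _ : Invertible (1 : Matrix n n 𝕜) := invertibleOne
  rw [star_eq_conjTranspose, PosDef.fromBlocks₁₁ K 1 PosDef.one, inv_one, Matrix.mul_one, le_iff]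

lemma posSemidef_fromBlocks_iff_mul_star_self_le_one :
    (fromBlocks 1 K (star K) 1).PosSemidef ↔ K * star K ≤ 1 := by
  let _ : Invertible (1 : Matrix n n 𝕜) := invertibleOne
  rw [star_eq_conjTranspose, PosDef.fromBlocks₂₂ 1 K PosDef.one, inv_one, Matrix.mul_one, le_iff]

lemma star_mul_self_le_one_iff : star K * K ≤ 1 ↔ K * star K ≤ 1 :=
  posSemidef_fromBlocks_iff_star_mul_self_le_one.symm.trans
    posSemidef_fromBlocks_iff_mul_star_self_le_one

lemma sum_sq_norm_col_le_one (hK : star K * K ≤ 1) (i : n) : ∑ j, ‖K j i‖ ^ 2 ≤ 1 := by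
  have h := (le_iff.mp hK).diag_nonneg (i := i)
  rw [Matrix.sub_apply, one_apply_eq, mul_apply, sub_nonneg] at h
  simp only [star_apply, RCLike.star_def, RCLike.conj_mul] at h
  exact_mod_cast h

end Contraction

section Trace

variable {n : Type*} [Fintype n]

lemma trace_re_mono {A B : Matrix n n ℂ} (h : A ≤ B) : A.trace.re ≤ B.trace.re :=
  (Complex.le_def.mp ((tracePositiveLinearMap n ℂ ℂ).monotone' h)).1

lemma trace_star_re (A : Matrix n n ℂ) : (star A).trace.re = A.trace.re := by
  rw [star_eq_conjTranspose, trace_conjTranspose, Complex.star_def, Complex.conj_re]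

lemma trace_real_smul_re (c : ℝ) (A : Matrix n n ℂ) : (c • A).trace.re = c * A.trace.re := by
  rw [trace_smul, Complex.smul_re, smul_eq_mul]

lemma real_smul_mul_star (c : ℝ) (A : Matrix n n ℂ) :
    c • A * star (c • A) = c ^ 2 • (A * star A) := by
  rw [star_smul, star_trivial, smul_mul_smul_comm, sq]

lemma isState_of_trace_re_eq_one {ω : Matrix n n ℂ} (hω : 0 ≤ ω) (h : ω.trace.re = 1) :
    IsState ω := by
  refine ⟨nonneg_iff_posSemidef.mp hω, Complex.ext h ?_⟩
  exact (Complex.le_def.mp (nonneg_iff_posSemidef.mp hω).trace_nonneg).2.symm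

lemma exists_isState_between {P Q : Matrix n n ℂ} (hP : 0 ≤ P) (hPQ : P ≤ Q) (hP1 : P.trace.re ≤ 1)
    (hQ1 : 1 ≤ Q.trace.re) : ∃ ω, IsState ω ∧ P ≤ ω ∧ ω ≤ Q := by
  let f : Matrix n n ℂ →ₗ[ℝ] ℝ := Complex.reLm ∘ₗ traceLinearMap n ℝ ℂ
  have h1 : (1 : ℝ) ∈ segment ℝ (f P) (f Q) :=
    (segment_eq_Icc (trace_re_mono hPQ)).ge ⟨hP1, hQ1⟩
  obtain ⟨ω, hω, htrace⟩ := (image_segment ℝ f.toAffineMap P Q).ge h1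
  obtain ⟨hPω, hωQ⟩ := segment_subset_Icc hPQ hω
  exact ⟨ω, isState_of_trace_re_eq_one (hP.trans hPω) htrace, hPω, hωQ⟩

end Trace

section Fidelity

variable {A K P T ω ρ : Matrix ι ι ℂ}

lemma star_sqrt (A : Matrix ι ι ℂ) : star (CFC.sqrt A) = CFC.sqrt A :=
  (CFC.sqrt_nonneg A).isSelfAdjoint

lemma trace_contraction_mul_le (hK : K * star K ≤ 1) (hP : 0 ≤ P) :
    (K * P).trace.re ≤ P.trace.re := by
  have hsq : CFC.sqrt P * star (CFC.sqrt P) = P := by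
    rw [star_sqrt, CFC.sqrt_mul_sqrt_self P hP]
  have hKPK : (K * P * star K).trace.re ≤ P.trace.re := by
    have h := trace_re_mono (mul_mul_star_le_of_contraction (CFC.sqrt P) (g := star K)
      (by rwa [star_star, star_mul_self_le_one_iff]))
    rwa [trace_mul_comm, hsq, star_mul, star_star, Matrix.mul_assoc,
      ← Matrix.mul_assoc _ _ (star K),
      star_sqrt, CFC.sqrt_mul_sqrt_self P hP, ← Matrix.mul_assoc] at h
  have hPK : (P * star K).trace.re = (K * P).trace.re := by
    rw [← trace_star_re (K * P), star_mul, (IsSelfAdjoint.of_nonneg hP).star_eq]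
  have hexp : (1 - K) * P * star (1 - K) = P - K * P - P * star K + K * P * star K := by
    rw [star_sub, star_one]
    noncomm_ring
  have h : 0 ≤ ((1 - K) * P * star (1 - K)).trace.re := by
    simpa using trace_re_mono (star_right_conjugate_nonneg hP (1 - K))
  simp only [hexp, trace_add, trace_sub, Complex.add_re, Complex.sub_re, hPK] at h
  linarith

lemma rpow_neg_half_eq_inv_sqrt {x : ℝ} (hx : 0 ≤ x) : x ^ (-1 / 2 : ℝ) = (√x)⁻¹ := by
  rw [neg_div, Real.rpow_neg hx, Real.sqrt_eq_rpow]

lemma rpow_neg_half_mul_self (hT : 0 ≤ T) : T ^ (-1 / 2 : ℝ) * T = CFC.sqrt T := by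
  obtain ⟨V, t, rfl⟩ := exists_eq_diagIn (nonneg_iff_posSemidef.mp hT).1
  have ht := posSemidef_diagIn_iff.mp (nonneg_iff_posSemidef.mp hT)
  rw [rpow_diagIn V ht, sqrt_diagIn V ht, ← map_mul]
  congr 1
  ext i
  rw [Pi.mul_apply, rpow_neg_half_eq_inv_sqrt (ht i), inv_mul_eq_div, Real.div_sqrt,
    Function.comp_apply]

lemma rpow_neg_half_mul_mul_rpow_neg_half_le_one (hT : 0 ≤ T) :
    T ^ (-1 / 2 : ℝ) * T * star (T ^ (-1 / 2 : ℝ)) ≤ 1 := by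
  rw [rpow_neg_half_mul_self hT]
  obtain ⟨V, t, rfl⟩ := exists_eq_diagIn (nonneg_iff_posSemidef.mp hT).1
  have ht := posSemidef_diagIn_iff.mp (nonneg_iff_posSemidef.mp hT)
  rw [rpow_diagIn V ht, sqrt_diagIn V ht, ← map_star, star_trivial, ← map_mul, ← map_one (diagIn V),
    le_iff, ← map_sub, posSemidef_diagIn_iff]
  intro i
  simp only [Pi.zero_apply, Pi.sub_apply, Pi.one_apply, Pi.mul_apply, Function.comp_apply,
    rpow_neg_half_eq_inv_sqrt (ht i), sub_nonneg, mul_inv_le_one]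

lemma sqrt_mul_rpow_neg_half_mul_of_le (hT : 0 ≤ T) (h : A * star A ≤ T) :
    CFC.sqrt T * (T ^ (-1 / 2 : ℝ) * A) = A := by
  set Q := 1 - CFC.sqrt T * T ^ (-1 / 2 : ℝ) with hQ
  have hQT : Q * T * star Q = 0 := by
    have hQT' : Q * T = 0 := by
      rw [hQ, Matrix.sub_mul, Matrix.one_mul, Matrix.mul_assoc, rpow_neg_half_mul_self hT,
        CFC.sqrt_mul_sqrt_self T hT, sub_self]
    rw [hQT', Matrix.zero_mul]
  have hQA : Q * A * star (Q * A) = 0 := by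
    refine le_antisymm ?_ (mul_star_self_nonneg _)
    have hle := star_right_conjugate_le_conjugate h Q
    rwa [hQT, ← Matrix.mul_assoc, Matrix.mul_assoc, ← star_mul] at hle
  have hQA' : Q * A = 0 := self_mul_conjTranspose_eq_zero.mp hQA
  rw [hQ, Matrix.sub_mul, Matrix.one_mul, sub_eq_zero, Matrix.mul_assoc] at hQA'
  exact hQA'.symm

lemma rpow_neg_half_mul_contraction_of_le (hT : 0 ≤ T) (h : A * star A ≤ T) :
    T ^ (-1 / 2 : ℝ) * A * star (T ^ (-1 / 2 : ℝ) * A) ≤ 1 := by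
  have hle := (star_right_conjugate_le_conjugate h (T ^ (-1 / 2 : ℝ))).trans
    (rpow_neg_half_mul_mul_rpow_neg_half_le_one hT)
  rwa [← Matrix.mul_assoc, Matrix.mul_assoc, ← star_mul] at hle

/-! ### The fidelity as an optimum over contractions -/

lemma sqrt_mul_sqrt_mul_star (ω : Matrix ι ι ℂ) (hρ : 0 ≤ ρ) :
    CFC.sqrt ω * CFC.sqrt ρ * star (CFC.sqrt ω * CFC.sqrt ρ) = CFC.sqrt ω * ρ * CFC.sqrt ω := by
  rw [star_mul, star_sqrt, star_sqrt, Matrix.mul_assoc, ← Matrix.mul_assoc (CFC.sqrt ρ),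
    CFC.sqrt_mul_sqrt_self ρ hρ, Matrix.mul_assoc]

lemma fidelity_nonneg (ω ρ : Matrix ι ι ℂ) : 0 ≤ fidelity ω ρ := by
  simpa [fidelity] using trace_re_mono (CFC.sqrt_nonneg (CFC.sqrt ω * ρ * CFC.sqrt ω))

lemma exists_fidelity_eq (hω : 0 ≤ ω) (hρ : 0 ≤ ρ) :
    ∃ A, A * star A ≤ ω ∧ (A * CFC.sqrt ρ).trace.re = fidelity ω ρ := by
  set M := CFC.sqrt ω * CFC.sqrt ρ with hM
  set T := CFC.sqrt ω * ρ * CFC.sqrt ω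
  have hMT : M * star M = T := sqrt_mul_sqrt_mul_star ω hρ
  have hT : 0 ≤ T := hMT ▸ mul_star_self_nonneg M
  refine ⟨CFC.sqrt ω * (T ^ (-1 / 2 : ℝ) * M), ?_, ?_⟩
  · have h := mul_mul_star_le_of_contraction (CFC.sqrt ω)
      (rpow_neg_half_mul_contraction_of_le hT hMT.le)
    rwa [star_sqrt ω, CFC.sqrt_mul_sqrt_self ω hω] at h
  · calc (CFC.sqrt ω * (T ^ (-1 / 2 : ℝ) * M) * CFC.sqrt ρ).trace.re
        = (T ^ (-1 / 2 : ℝ) * (M * star M)).trace.re := by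
          rw [Matrix.mul_assoc, trace_mul_comm, hM, star_mul, star_sqrt, star_sqrt]
          simp only [Matrix.mul_assoc]
      _ = fidelity ω ρ := by rw [hMT, rpow_neg_half_mul_self hT, fidelity]

lemma trace_mul_sqrt_le_fidelity (hω : 0 ≤ ω) (hρ : 0 ≤ ρ) (h : A * star A ≤ ω) :
    (A * CFC.sqrt ρ).trace.re ≤ fidelity ω ρ := by
  set M := CFC.sqrt ω * CFC.sqrt ρ with hM
  set T := CFC.sqrt ω * ρ * CFC.sqrt ω
  have hMT : M * star M = T := sqrt_mul_sqrt_mul_star ω hρ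
  have hT : 0 ≤ T := hMT ▸ mul_star_self_nonneg M
  set G := ω ^ (-1 / 2 : ℝ) * A
  set K := T ^ (-1 / 2 : ℝ) * M
  have hAG : CFC.sqrt ω * G = A := sqrt_mul_rpow_neg_half_mul_of_le hω h
  have hMK : CFC.sqrt T * K = M := sqrt_mul_rpow_neg_half_mul_of_le hT hMT.le
  have hG : star G * star (star G) ≤ 1 := by
    rw [star_star, star_mul_self_le_one_iff]
    exact rpow_neg_half_mul_contraction_of_le hω h
  have hK : K * star G * star (K * star G) ≤ 1 :=
    (mul_mul_star_le_of_contraction K hG).trans (rpow_neg_half_mul_contraction_of_le hT hMT.le)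
  calc (A * CFC.sqrt ρ).trace.re
      = (star (G * star M)).trace.re := by
        rw [trace_star_re, ← hAG, hM, star_mul, star_sqrt, star_sqrt, Matrix.mul_assoc,
          trace_mul_comm, Matrix.mul_assoc]
    _ = (K * star G * CFC.sqrt T).trace.re := by
        rw [star_mul, star_star, ← hMK, Matrix.mul_assoc, trace_mul_comm]
    _ ≤ fidelity ω ρ := trace_contraction_mul_le hK (CFC.sqrt_nonneg T)

end Fidelity

/-! ### Schur multipliers -/

section Schur

variable {n 𝕜 : Type*} [RCLike 𝕜]

lemma posSemidef_min [Finite n] {c : n → ℝ} (hc : 0 ≤ c) :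
    (Matrix.of fun i j => ((min (c i) (c j) : ℝ) : 𝕜)).PosSemidef := by
  let v : n → MeasureTheory.Lp 𝕜 2 (MeasureTheory.volume : MeasureTheory.Measure ℝ) := fun i =>
    MeasureTheory.indicatorConstLp 2 (measurableSet_Ico (a := 0) (b := c i)) (by simp) 1
  convert! posSemidef_gram 𝕜 v
  ext i j
  rw [of_apply, gram_apply, MeasureTheory.L2.inner_indicatorConstLp_one_indicatorConstLp_one _ _
      measure_Ico_lt_top.ne measure_Ico_lt_top.ne,
    Set.Ico_inter_Ico, max_self, Real.volume_real_Ico, sub_zero,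
    max_eq_left (show (0 : ℝ) ≤ min (c i) (c j) from le_min (hc i) (hc j))]

lemma schurMultiplier_contraction [Fintype n] [DecidableEq n] {K : Matrix (n ⊕ n) (n ⊕ n) 𝕜}
    (hK : K.PosSemidef) (hdiag : ∀ p, K p p ≤ 1) {U : Matrix n n 𝕜} (hU : star U * U ≤ 1) :
    star (K.toBlocks₁₂ ⊙ U) * (K.toBlocks₁₂ ⊙ U) ≤ 1 := by
  have hprod := hK.hadamard (posSemidef_fromBlocks_iff_star_mul_self_le_one.mpr hU)
  have hslack : (diagonal fun p => 1 - K p p).PosSemidef :=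
    PosSemidef.diagonal fun p => sub_nonneg.mpr (hdiag p)
  rw [← posSemidef_fromBlocks_iff_star_mul_self_le_one]
  convert! hprod.add hslack
  ext (i | i) (j | j)
  · by_cases hij : i = j <;> simp [hij]
  · simp [toBlocks₁₂]
  · simp [toBlocks₁₂, ← hK.1.apply (Sum.inr i) (Sum.inl j)]
  · by_cases hij : i = j <;> simp [hij]

end Schur

/-- The kernel `min a b / √(a b)` on `[0, ∞)`, with value `0` if `a = 0` or `b = 0`. It equals
`exp (-|x - y| / 2)` for `a = exp x` and `b = exp y`, so it is positive definite. -/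
def expKernel (a b : ℝ) : ℝ := (√a)⁻¹ * min a b * (√b)⁻¹

lemma expKernel_self_le_one (a : ℝ) : expKernel a a ≤ 1 := by
  rw [expKernel, min_self, inv_mul_eq_div, Real.div_sqrt]
  exact mul_inv_le_one

lemma sqrt_mul_expKernel_mul_sqrt {a b : ℝ} (ha : 0 ≤ a) (hb : 0 ≤ b) :
    √a * expKernel a b * √b = min a b := by
  rcases ha.eq_or_lt with rfl | ha
  · simp [hb]
  rcases hb.eq_or_lt with rfl | hb
  · simp [ha.le]
  have ha' : √a ≠ 0 := (Real.sqrt_pos.mpr ha).ne'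
  have hb' : √b ≠ 0 := (Real.sqrt_pos.mpr hb).ne'
  rw [expKernel]
  field_simp

lemma mul_expKernel_sq_le_min {a b : ℝ} (ha : 0 ≤ a) (hb : 0 ≤ b) :
    b * expKernel a b ^ 2 ≤ min a b := by
  rcases ha.eq_or_lt with rfl | ha
  · simp [expKernel, hb]
  rcases hb.eq_or_lt with rfl | hb
  · simp [ha.le]
  have hmin : 0 ≤ min a b := le_min ha.le hb.le
  calc b * expKernel a b ^ 2 = min a b * (min a b / a) := by
        rw [expKernel, mul_pow, mul_pow, inv_pow, inv_pow, Real.sq_sqrt ha.le, Real.sq_sqrt hb.le]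
        field_simp
    _ ≤ min a b := mul_le_of_le_one_right hmin ((div_le_one ha).mpr (min_le_left a b))

lemma posSemidef_expKernel {n : Type*} [Finite n] {c : n → ℝ} (hc : 0 ≤ c) :
    (Matrix.of fun i j => (expKernel (c i) (c j) : ℂ)).PosSemidef := by
  classical
  have := Fintype.ofFinite n
  convert! (posSemidef_min (𝕜 := ℂ) hc).mul_mul_conjTranspose_same
    (diagonal fun i => (((√(c i))⁻¹ : ℝ) : ℂ))
  ext i j
  rw [diagonal_conjTranspose, mul_diagonal, diagonal_mul]
  simp [expKernel]

lemma expKernel_mul_contraction {n : Type*} [Fintype n] [DecidableEq n] {U : Matrix n n ℂ}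
    (hU : star U * U ≤ 1) {a b : n → ℝ} (ha : 0 ≤ a) (hb : 0 ≤ b) :
    star (Matrix.of fun i j => expKernel (a i) (b j) * U i j)
      * Matrix.of (fun i j => expKernel (a i) (b j) * U i j) ≤ 1 := by
  have hc : 0 ≤ Sum.elim a b := by
    rintro (i | i)
    exacts [ha i, hb i]
  exact schurMultiplier_contraction (posSemidef_expKernel hc)
    (fun p => by
      rw [of_apply]
      exact_mod_cast expKernel_self_le_one (Sum.elim a b p)) hU

/-! ### Smoothing states -/

section Smoothing

variable {Q B ρ : Matrix ι ι ℂ}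

lemma exists_isState_le_mul_fidelity (hB : B * star B ≤ Q) (hQ : 1 ≤ Q.trace.re) (hρ : 0 ≤ ρ) :
    ∃ ω, IsState ω ∧ ω ≤ Q ∧
      (B * CFC.sqrt ρ).trace.re ≤ max 1 √(B * star B).trace.re * fidelity ω ρ := by
  set t := (B * star B).trace.re
  have hBB : 0 ≤ B * star B := mul_star_self_nonneg B
  rcases le_total t 1 with ht | ht
  · obtain ⟨ω, hω, hBω, hωQ⟩ := exists_isState_between hBB hB ht hQ
    refine ⟨ω, hω, hωQ, (trace_mul_sqrt_le_fidelity (hBB.trans hBω) hρ hBω).trans ?_⟩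
    exact le_mul_of_one_le_left (fidelity_nonneg ω ρ) (le_max_left _ _)
  · have ht0 : 0 < t := one_pos.trans_le ht
    have hω : 0 ≤ t⁻¹ • (B * star B) := smul_nonneg (inv_nonneg.mpr ht0.le) hBB
    have hnorm : (√t)⁻¹ • B * star ((√t)⁻¹ • B) = t⁻¹ • (B * star B) := by
      rw [real_smul_mul_star, inv_pow, Real.sq_sqrt ht0.le]
    refine ⟨t⁻¹ • (B * star B), isState_of_trace_re_eq_one hω ?_, ?_, ?_⟩
    · rw [trace_real_smul_re, inv_mul_cancel₀ ht0.ne']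
    · exact (smul_le_of_le_one_left hBB (inv_le_one_of_one_le₀ ht)).trans hB
    · have h := trace_mul_sqrt_le_fidelity hω hρ hnorm.le
      rw [Matrix.smul_mul, trace_real_smul_re, inv_mul_le_iff₀ (Real.sqrt_pos.mpr ht0)] at h
      exact h.trans (mul_le_mul_of_nonneg_right (le_max_right _ _) (fidelity_nonneg _ ρ))

end Smoothing

lemma trace_diagIn_mul_mul_star (V W : unitaryGroup ι ℂ) (f : ι → ℝ) (G : Matrix ι ι ℂ) :
    (diagIn W f * G * star (diagIn W f * G)).trace.re
      = ∑ i, ∑ j, f j ^ 2 * ‖(star (W : Matrix ι ι ℂ) * G * V) j i‖ ^ 2 := by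
  set M := diagonal (fun j => (f j : ℂ)) * (star (W : Matrix ι ι ℂ) * G * V) with hM
  have hG : diagIn W f * G = W * M * star (V : Matrix ι ι ℂ) := by
    simp only [diagIn_apply, hM, Matrix.mul_assoc, Unitary.mul_star_self_of_mem V.2,
      Matrix.mul_one]
  have htrace : (diagIn W f * G * star (diagIn W f * G)).trace = (M * star M).trace := by
    calc (diagIn W f * G * star (diagIn W f * G)).trace
        = (W * (M * (star (V : Matrix ι ι ℂ) * V) * star M * star (W : Matrix ι ι ℂ))).trace := by
          rw [hG]
          simp only [star_mul, star_star, Matrix.mul_assoc]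
      _ = (M * star M).trace := by
          rw [Unitary.star_mul_self_of_mem V.2, Matrix.mul_one, trace_mul_comm, Matrix.mul_assoc,
            Unitary.star_mul_self_of_mem W.2, Matrix.mul_one]
  rw [htrace, trace, Complex.re_sum, Finset.sum_comm]
  refine Finset.sum_congr rfl fun j _ => ?_
  rw [diag_apply, mul_apply, Complex.re_sum]
  refine Finset.sum_congr rfl fun i _ => ?_
  rw [star_apply, Complex.star_def, Complex.mul_conj, Complex.ofReal_re, hM, diagonal_mul,
    Complex.normSq_eq_norm_sq, norm_mul, mul_pow, Complex.norm_real, Real.norm_eq_abs, sq_abs]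

/-- The mass `∑ min(rᵢ, sⱼ) |⟨vᵢ, wⱼ⟩|²` that the Nussbaum–Szkoła distributions `rᵢ |⟨vᵢ, wⱼ⟩|²`
and `sⱼ |⟨vᵢ, wⱼ⟩|²` of `V diag(r) V*` and `W diag(s) W*` have in common. -/
def commonMass (V W : unitaryGroup ι ℂ) (r s : ι → ℝ) : ℝ :=
  ∑ i, ∑ j, min (r i) (s j) * overlap V W i j

/-- The Nussbaum–Szkoła distribution `rᵢ |⟨vᵢ, wⱼ⟩|²` of a pair of eigenbases, for the
eigenvalues `r` of the first operator. -/
def jointDist (V W : unitaryGroup ι ℂ) (r : ι → ℝ) (p : ι × ι) : ℝ :=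
  r p.1 * overlap V W p.1 p.2

section OneShot

variable {r s : ι → ℝ}

lemma commonMass_nonneg (V W : unitaryGroup ι ℂ) (hr : 0 ≤ r) (hs : 0 ≤ s) :
    0 ≤ commonMass V W r s :=
  Finset.sum_nonneg fun i _ => Finset.sum_nonneg fun j _ =>
    mul_nonneg (le_min (hr i) (hs j)) (overlap_nonneg V W i j)

lemma jointDist_nonneg (V W : unitaryGroup ι ℂ) (hr : 0 ≤ r) (p : ι × ι) :
    0 ≤ jointDist V W r p :=
  mul_nonneg (hr p.1) (overlap_nonneg V W p.1 p.2)

lemma sum_jointDist (V W : unitaryGroup ι ℂ) (r : ι → ℝ) :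
    ∑ p, jointDist V W r p = ∑ i, r i := by
  simp only [jointDist, Fintype.sum_prod_type, ← Finset.mul_sum, sum_overlap_right, mul_one]

lemma diagIn_sqrt_mul_star (W : unitaryGroup ι ℂ) (hs : 0 ≤ s) :
    diagIn W (Real.sqrt ∘ s) * star (diagIn W (Real.sqrt ∘ s)) = diagIn W s := by
  rw [← map_star, star_trivial, ← map_mul]
  exact congrArg (diagIn W) (funext fun j => Real.mul_self_sqrt (hs j))

lemma exists_trace_mul_sqrt_eq_commonMass (V W : unitaryGroup ι ℂ) (hr : 0 ≤ r) (hs : 0 ≤ s) :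
    ∃ A, A * star A ≤ diagIn W s ∧ (A * CFC.sqrt (diagIn V r)).trace.re = commonMass V W r s ∧
      (A * star A).trace.re ≤ commonMass V W r s := by
  set U := star (V : Matrix ι ι ℂ) * W with hU
  have hUU : star U * U ≤ 1 := (Unitary.star_mul_self_of_mem (star V * W).2).le
  set C := Matrix.of fun i j => (expKernel (r i) (s j) : ℂ) * U i j with hC
  have hCC : star C * C ≤ 1 := expKernel_mul_contraction hUU hr hs
  set G := W * star C * star (V : Matrix ι ι ℂ) with hG
  have hGC : star (W : Matrix ι ι ℂ) * G * V = star C := by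
    rw [hG, Matrix.mul_assoc, Matrix.mul_assoc, Unitary.star_mul_self_of_mem V.2, Matrix.mul_one,
      ← Matrix.mul_assoc, Unitary.star_mul_self_of_mem W.2, Matrix.one_mul]
  have hGG : G * star G ≤ 1 := by
    have h : G * star G = W * star C * star (W * star C) := by
      rw [hG, star_mul, star_star, Matrix.mul_assoc, ← Matrix.mul_assoc _ (V : Matrix ι ι ℂ),
        Unitary.star_mul_self_of_mem V.2, Matrix.one_mul]
    rw [h, ← Unitary.mul_star_self_of_mem W.2]
    exact mul_mul_star_le_of_contraction _ (by rwa [star_star])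
  refine ⟨diagIn W (Real.sqrt ∘ s) * G, ?_, ?_, ?_⟩
  · exact (mul_mul_star_le_of_contraction _ hGG).trans_eq (diagIn_sqrt_mul_star W hs)
  · rw [sqrt_diagIn V hr, trace_diagIn_mul_mul_diagIn, hGC, commonMass]
    simp only [Complex.re_sum]
    refine Finset.sum_congr rfl fun i _ => Finset.sum_congr rfl fun j _ => ?_
    rw [star_apply, Complex.star_def, hC, of_apply, map_mul, Complex.conj_ofReal, ← hU,
      mul_assoc (expKernel (r i) (s j) : ℂ), ← Complex.normSq_eq_conj_mul_self,
      ← sqrt_mul_expKernel_mul_sqrt (hr i) (hs j), overlap]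
    simp only [Function.comp_apply, ← Complex.ofReal_mul, Complex.ofReal_re]
    ring
  · rw [trace_diagIn_mul_mul_star V W, hGC, commonMass]
    refine Finset.sum_le_sum fun i _ => Finset.sum_le_sum fun j _ => ?_
    rw [star_apply, norm_star, hC, of_apply, norm_mul, mul_pow, Complex.norm_real,
      Real.norm_eq_abs, sq_abs, Function.comp_apply, Real.sq_sqrt (hs j), ← mul_assoc,
      ← Complex.normSq_eq_norm_sq]
    exact mul_le_mul_of_nonneg_right (mul_expKernel_sq_le_min (hr i) (hs j))
      (overlap_nonneg V W i j)

lemma exists_isState_le_smul_le_fidelity (V W : unitaryGroup ι ℂ) (hr : 0 ≤ r) (hs : 0 ≤ s) {c : ℝ}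
    (hc : 0 < c) (hcs : 1 ≤ c * ∑ j, s j) :
    ∃ ω, IsState ω ∧ ω ≤ c • diagIn W s ∧
      min (√c * commonMass V W r s) √(commonMass V W r s) ≤ fidelity ω (diagIn V r) := by
  set m := commonMass V W r s
  have hm : 0 ≤ m := commonMass_nonneg V W hr hs
  obtain ⟨A, hAs, hAtr, hAA⟩ := exists_trace_mul_sqrt_eq_commonMass V W hr hs
  have hB : √c • A * star (√c • A) ≤ c • diagIn W s := by
    rw [real_smul_mul_star, Real.sq_sqrt hc.le]
    exact smul_le_smul_of_nonneg_left hAs hc.le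
  have hBtr : (√c • A * star (√c • A)).trace.re ≤ c * m := by
    rw [real_smul_mul_star, Real.sq_sqrt hc.le, trace_real_smul_re]
    exact mul_le_mul_of_nonneg_left hAA hc.le
  obtain ⟨ω, hω, hωs, hF⟩ := exists_isState_le_mul_fidelity hB
    (by rwa [trace_real_smul_re, trace_diagIn, Complex.ofReal_re])
    (posSemidef_diagIn_iff.mpr hr).nonneg
  refine ⟨ω, hω, hωs, ?_⟩
  have hF0 := fidelity_nonneg ω (diagIn V r)
  rw [Matrix.smul_mul, trace_real_smul_re, hAtr] at hF
  rcases hm.eq_or_lt with hm0 | hm0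
  · rw [← hm0, mul_zero, Real.sqrt_zero, min_self]
    exact hF0
  rcases le_total √(√c • A * star (√c • A)).trace.re 1 with h | h
  · rw [max_eq_left h, one_mul] at hF
    exact (min_le_left _ _).trans hF
  · refine (min_le_right _ _).trans (le_of_mul_le_mul_left ?_ (Real.sqrt_pos.mpr (mul_pos hc hm0)))
    calc √(c * m) * √m = √c * m := by
          rw [Real.sqrt_mul hc.le, mul_assoc, Real.mul_self_sqrt hm]
      _ ≤ √(√c • A * star (√c • A)).trace.re * fidelity ω (diagIn V r) := by
          rwa [max_eq_right h] at hF
      _ ≤ √(c * m) * fidelity ω (diagIn V r) :=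
          mul_le_mul_of_nonneg_right (Real.sqrt_le_sqrt hBtr) hF0

lemma exists_fidelity_le_sum {ω : Matrix ι ι ℂ} (V W : unitaryGroup ι ℂ) (hr : 0 ≤ r)
    (hs : 0 ≤ s) (hω : 0 ≤ ω) (hle : ω ≤ diagIn W s) :
    ∃ y : ι × ι → ℝ, 0 ≤ y ∧ (∀ i, ∑ j, y (i, j) ≤ 1) ∧ ∑ p, s p.2 * y p ≤ ω.trace.re ∧
      fidelity ω (diagIn V r) ≤ ∑ p, √(s p.2 * y p) * √(jointDist V W r p) := by
  obtain ⟨A, hAω, hF⟩ := exists_fidelity_eq hω (posSemidef_diagIn_iff.mpr hr).nonneg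
  have hT : 0 ≤ diagIn W s := hω.trans hle
  set G := diagIn W s ^ (-1 / 2 : ℝ) * A
  have hAG : diagIn W (Real.sqrt ∘ s) * G = A := by
    rw [← sqrt_diagIn W hs, sqrt_mul_rpow_neg_half_mul_of_le hT (hAω.trans hle)]
  have hGG : star G * G ≤ 1 :=
    star_mul_self_le_one_iff.mpr (rpow_neg_half_mul_contraction_of_le hT (hAω.trans hle))
  set Y := star (W : Matrix ι ι ℂ) * G * V with hY
  have hYY : star Y * Y ≤ 1 := by
    have h : star Y * Y = star (V : Matrix ι ι ℂ) * (star G * G) * V := by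
      rw [hY, star_mul, star_mul, star_star]
      simp only [Matrix.mul_assoc]
      rw [← Matrix.mul_assoc (W : Matrix ι ι ℂ), Unitary.mul_star_self_of_mem W.2, Matrix.one_mul]
    rw [h, ← Unitary.star_mul_self_of_mem V.2]
    exact (star_left_conjugate_le_conjugate hGG _).trans_eq (by rw [Matrix.mul_one])
  refine ⟨fun p => ‖Y p.2 p.1‖ ^ 2, fun p => sq_nonneg _, sum_sq_norm_col_le_one hYY, ?_, ?_⟩
  · refine le_trans (le_of_eq ?_) (trace_re_mono hAω)
    rw [← hAG, trace_diagIn_mul_mul_star V W, Fintype.sum_prod_type]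
    simp only [Function.comp_apply, Real.sq_sqrt (hs _), hY]
  · rw [← hF, ← hAG, sqrt_diagIn V hr, trace_diagIn_mul_mul_diagIn, Fintype.sum_prod_type]
    simp only [Complex.re_sum]
    refine Finset.sum_le_sum fun i _ => Finset.sum_le_sum fun j _ => ?_
    refine (Complex.re_le_norm _).trans (le_of_eq ?_)
    rw [jointDist, Real.sqrt_mul (hs j), Real.sqrt_mul (hr i), overlap, Complex.normSq_eq_norm_sq,
      Real.sqrt_sq (norm_nonneg _), Real.sqrt_sq (norm_nonneg _)]
    simp only [norm_mul, Complex.norm_real, Real.norm_eq_abs, abs_of_nonneg (Real.sqrt_nonneg _),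
      Function.comp_apply, hY]
    ring

lemma sum_sqrt_mul_sqrt_le_binary {κ : Type*} [Fintype κ] {q p : κ → ℝ}
    (hq : 0 ≤ q) (hp : 0 ≤ p) (hq1 : ∑ x, q x ≤ 1) (hp1 : ∑ x, p x = 1) (S : Finset κ) :
    ∑ x, √(q x) * √(p x) ≤ √(∑ x ∈ S, q x) * √(∑ x ∈ S, p x)
      + √(1 - ∑ x ∈ S, q x) * √(1 - ∑ x ∈ S, p x) := by
  classical
  have hpS : ∑ x ∈ Sᶜ, p x = 1 - ∑ x ∈ S, p x := by
    rw [← hp1, ← Finset.sum_add_sum_compl S, add_sub_cancel_left]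
  have hqS : ∑ x ∈ Sᶜ, q x ≤ 1 - ∑ x ∈ S, q x := by
    rw [← Finset.sum_add_sum_compl S] at hq1
    linarith
  rw [← Finset.sum_add_sum_compl S, ← hpS]
  refine add_le_add (Real.sum_sqrt_mul_sqrt_le S hq hp) ?_
  exact (Real.sum_sqrt_mul_sqrt_le Sᶜ hq hp).trans
    (mul_le_mul_of_nonneg_right (Real.sqrt_le_sqrt hqS) (Real.sqrt_nonneg _))

lemma exists_fidelity_le_binary {ω : Matrix ι ι ℂ} (V W : unitaryGroup ι ℂ) (hr : 0 ≤ r)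
    (hr1 : ∑ i, r i = 1) (hs : 0 ≤ s) (hω : IsState ω) (hle : ω ≤ diagIn W s) {c : ℝ}
    {S : Finset (ι × ι)} (hS : ∀ p ∈ S, c * s p.2 ≤ r p.1) :
    ∃ a : ℝ, 0 ≤ a ∧ a ≤ 1 ∧ c * a ≤ 1 ∧ fidelity ω (diagIn V r) ≤
      √a * √(∑ p ∈ S, jointDist V W r p) + √(1 - a) * √(1 - ∑ p ∈ S, jointDist V W r p) := by
  obtain ⟨y, hy, hy1, hsy, hF⟩ := exists_fidelity_le_sum V W hr hs hω.1.nonneg hle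
  rw [hω.2, Complex.one_re] at hsy
  have hq : 0 ≤ fun p : ι × ι => s p.2 * y p := fun p => mul_nonneg (hs p.2) (hy p)
  refine ⟨∑ p ∈ S, s p.2 * y p, Finset.sum_nonneg fun p _ => hq p,
    (Finset.sum_le_univ_sum_of_nonneg hq).trans hsy, ?_, hF.trans ?_⟩
  · calc c * ∑ p ∈ S, s p.2 * y p = ∑ p ∈ S, c * s p.2 * y p := by
          simp only [Finset.mul_sum, mul_assoc]
      _ ≤ ∑ p ∈ S, r p.1 * y p :=
          Finset.sum_le_sum fun p hp => mul_le_mul_of_nonneg_right (hS p hp) (hy p)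
      _ ≤ ∑ p, r p.1 * y p :=
          Finset.sum_le_univ_sum_of_nonneg fun p => mul_nonneg (hr p.1) (hy p)
      _ = ∑ i, r i * ∑ j, y (i, j) := by simp only [Fintype.sum_prod_type, Finset.mul_sum]
      _ ≤ ∑ i, r i := Finset.sum_le_sum fun i _ => mul_le_of_le_one_right (hr i) (hy1 i)
      _ = 1 := hr1
  · exact sum_sqrt_mul_sqrt_le_binary hq (jointDist_nonneg V W hr) hsy
      ((sum_jointDist V W r).trans hr1) S

end OneShot

/-! ### Distribution functions of centred random variables -/

section FiniteDistribution

variable {κ : Type*} [Fintype κ] {p w : κ → ℝ}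

/-- The distribution function of a random variable `w` on a finite set with weights `p`. -/
def cdf (p w : κ → ℝ) (t : ℝ) : ℝ := ∑ i with w i ≤ t, p i

/-- The expectation of the negative part of a random variable `w` on a finite set with
weights `p`. -/
def meanNeg (p w : κ → ℝ) : ℝ := ∑ i, p i * max (-w i) 0

lemma cdf_eq_sum_indicator (p w : κ → ℝ) (t : ℝ) :
    cdf p w t = ∑ i, p i * (Set.Ici (w i)).indicator 1 t := by
  simp only [cdf, Finset.sum_filter, Set.indicator_apply, Set.mem_Ici, Pi.one_apply, mul_ite,
    mul_one, mul_zero]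

lemma meanNeg_eq_sum_filter (p w : κ → ℝ) : meanNeg p w = ∑ i with w i ≤ 0, p i * -w i := by
  rw [meanNeg, Finset.sum_filter]
  refine Finset.sum_congr rfl fun i _ => ?_
  split_ifs with hi
  · rw [max_eq_left (neg_nonneg.mpr hi)]
  · rw [max_eq_right (neg_nonpos.mpr (not_le.mp hi).le), mul_zero]

lemma sum_mul_max_eq_meanNeg_add (p w : κ → ℝ) :
    ∑ i, p i * max (w i) 0 = meanNeg p w + ∑ i, p i * w i := by
  rw [meanNeg, ← Finset.sum_add_distrib]
  refine Finset.sum_congr rfl fun i _ => ?_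
  rw [← mul_add, ← max_add_add_right, neg_add_cancel, zero_add, max_comm]

lemma one_sub_mgf_mul_exp_le_cdf (hp : 0 ≤ p) (hp1 : ∑ i, p i = 1) {θ : ℝ} (hθ : 0 ≤ θ) (t : ℝ) :
    1 - (∑ i, p i * Real.exp (θ * w i)) * Real.exp (-(θ * t)) ≤ cdf p w t := by
  calc 1 - (∑ i, p i * Real.exp (θ * w i)) * Real.exp (-(θ * t))
      = ∑ i, p i * (1 - Real.exp (θ * w i - θ * t)) := by
        simp only [mul_sub, mul_one, Finset.sum_sub_distrib, hp1, Finset.sum_mul, mul_assoc,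
          ← Real.exp_add, ← sub_eq_add_neg]
    _ ≤ cdf p w t := by
        rw [cdf_eq_sum_indicator]
        refine Finset.sum_le_sum fun i _ => mul_le_mul_of_nonneg_left ?_ (hp i)
        rcases le_or_gt (w i) t with h | h
        · rw [Set.indicator_of_mem (Set.mem_Ici.mpr h)]
          exact sub_le_self _ (Real.exp_pos _).le
        · rw [Set.indicator_of_notMem (Set.notMem_Ici.mpr h), sub_nonpos, Real.one_le_exp_iff,
            sub_nonneg]
          exact mul_le_mul_of_nonneg_left h.le hθ

-- Young's inequality for the pair of conjugate functions `exp` and `b ↦ b log b - b`.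
lemma mul_meanNeg_le_mgf_mul_exp_add (hp : 0 ≤ p) (θ b : ℝ) :
    θ * meanNeg p w ≤ (∑ i, p i * Real.exp (-θ * w i)) * Real.exp (-b) + (b - 1) * cdf p w 0 := by
  have hpoint : ∀ i, θ * -w i ≤ Real.exp (-θ * w i) * Real.exp (-b) + (b - 1) := fun i => by
    have h := Real.add_one_le_exp (-θ * w i + -b)
    rw [Real.exp_add] at h
    linarith
  calc θ * meanNeg p w = ∑ i with w i ≤ 0, p i * (θ * -w i) := by
        rw [meanNeg_eq_sum_filter, Finset.mul_sum]
        exact Finset.sum_congr rfl fun i _ => mul_left_comm _ _ _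
    _ ≤ ∑ i with w i ≤ 0, p i * (Real.exp (-θ * w i) * Real.exp (-b) + (b - 1)) :=
        Finset.sum_le_sum fun i _ => mul_le_mul_of_nonneg_left (hpoint i) (hp i)
    _ = (∑ i with w i ≤ 0, p i * Real.exp (-θ * w i)) * Real.exp (-b) + (b - 1) * cdf p w 0 := by
        rw [cdf, mul_comm (b - 1)]
        simp only [mul_add, Finset.sum_add_distrib, Finset.sum_mul, mul_assoc]
    _ ≤ _ := by
        refine add_le_add_left (mul_le_mul_of_nonneg_right ?_ (Real.exp_pos _).le) _
        exact Finset.sum_le_univ_sum_of_nonneg fun i => mul_nonneg (hp i) (Real.exp_pos _).le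

lemma cdf_nonneg (hp : 0 ≤ p) (t : ℝ) : 0 ≤ cdf p w t :=
  Finset.sum_nonneg fun i _ => hp i

lemma sq_meanNeg_le (hp : 0 ≤ p) : meanNeg p w ^ 2 ≤ cdf p w 0 * ∑ i, p i * w i ^ 2 := by
  calc meanNeg p w ^ 2 = (∑ i with w i ≤ 0, p i * -w i) ^ 2 := by rw [meanNeg_eq_sum_filter]
    _ ≤ cdf p w 0 * ∑ i with w i ≤ 0, p i * w i ^ 2 :=
        Finset.sum_sq_le_sum_mul_sum_of_sq_le_mul _ (fun i _ => hp i)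
          (fun i _ => mul_nonneg (hp i) (sq_nonneg _)) fun i _ => le_of_eq (by ring)
    _ ≤ cdf p w 0 * ∑ i, p i * w i ^ 2 :=
        mul_le_mul_of_nonneg_left (Finset.sum_le_univ_sum_of_nonneg fun i =>
          mul_nonneg (hp i) (sq_nonneg _)) (cdf_nonneg hp 0)

lemma monotone_indicator_Ici_one (x : ℝ) : Monotone ((Set.Ici x).indicator (1 : ℝ → ℝ)) := by
  intro s t hst
  by_cases hs : x ≤ s
  · rw [Set.indicator_of_mem (Set.mem_Ici.mpr (hs.trans hst)),
      Set.indicator_of_mem (Set.mem_Ici.mpr hs)]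
    exact le_rfl
  · rw [Set.indicator_of_notMem (mt Set.mem_Ici.mp hs)]
    exact Set.indicator_nonneg (fun _ _ => zero_le_one) t

lemma sub_max_le_integral_indicator_Ici (x : ℝ) {T : ℝ} (hT : 0 ≤ T) :
    T - max x 0 ≤ ∫ t in (0 : ℝ)..T, (Set.Ici x).indicator 1 t := by
  have hint : ∀ a b, IntervalIntegrable ((Set.Ici x).indicator (1 : ℝ → ℝ)) MeasureTheory.volume
      a b := fun a b => (monotone_indicator_Ici_one x).intervalIntegrable
  have hnonneg : ∀ b, 0 ≤ b → 0 ≤ ∫ t in (0 : ℝ)..b, (Set.Ici x).indicator (1 : ℝ → ℝ) t :=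
    fun b hb => intervalIntegral.integral_nonneg hb fun t _ =>
      Set.indicator_nonneg (fun _ _ => zero_le_one) t
  rcases le_total T (max x 0) with h | h
  · exact (sub_nonpos.mpr h).trans (hnonneg T hT)
  calc T - max x 0 = ∫ _ in (max x 0)..T, (1 : ℝ) := by
        rw [intervalIntegral.integral_const, smul_eq_mul, mul_one]
    _ ≤ ∫ t in (max x 0)..T, (Set.Ici x).indicator 1 t :=
        intervalIntegral.integral_mono_on h (by simp) (hint _ _) fun t ht => by
          rw [Set.indicator_of_mem (Set.mem_Ici.mpr ((le_max_left _ _).trans ht.1)), Pi.one_apply]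
    _ ≤ ∫ t in (0 : ℝ)..T, (Set.Ici x).indicator 1 t := by
        rw [← intervalIntegral.integral_add_adjacent_intervals (hint 0 (max x 0)) (hint _ T)]
        exact le_add_of_nonneg_left (hnonneg _ (le_max_right _ _))

lemma monotone_cdf (hp : 0 ≤ p) : Monotone (cdf p w) := fun _ _ hst =>
  Finset.sum_le_sum_of_subset_of_nonneg
    (Finset.monotone_filter_right _ fun _ _ hi => le_trans hi hst) fun i _ _ => hp i

lemma sub_integral_cdf_le (hp : 0 ≤ p) (hp1 : ∑ i, p i = 1) {T : ℝ} (hT : 0 ≤ T) :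
    T - ∫ t in (0 : ℝ)..T, cdf p w t ≤ ∑ i, p i * max (w i) 0 := by
  have hcdf : ∫ t in (0 : ℝ)..T, cdf p w t
      = ∑ i, p i * ∫ t in (0 : ℝ)..T, (Set.Ici (w i)).indicator 1 t := by
    simp only [cdf_eq_sum_indicator]
    rw [intervalIntegral.integral_finsetSum fun i _ =>
      ((monotone_indicator_Ici_one (w i)).intervalIntegrable).const_mul _]
    simp only [intervalIntegral.integral_const_mul]
  calc T - ∫ t in (0 : ℝ)..T, cdf p w t
      = ∑ i, p i * (T - ∫ t in (0 : ℝ)..T, (Set.Ici (w i)).indicator 1 t) := by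
        simp only [mul_sub, Finset.sum_sub_distrib, ← Finset.sum_mul, hp1, one_mul, hcdf]
    _ ≤ ∑ i, p i * max (w i) 0 := Finset.sum_le_sum fun i _ =>
        mul_le_mul_of_nonneg_left (by linarith [sub_max_le_integral_indicator_Ici (w i) hT]) (hp i)

lemma integral_add_exp_le (a T : ℝ) {c : ℝ} (hc : 0 < c) :
    ∫ t in (0 : ℝ)..T, (a + Real.exp (c * (t - T))) ≤ a * T + 1 / c := by
  have hexp : ∫ t in (0 : ℝ)..T, Real.exp (c * (t - T)) = (1 - Real.exp (-(c * T))) / c := by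
    simp only [mul_sub]
    rw [intervalIntegral.integral_comp_mul_sub _ hc.ne', integral_exp, sub_self, Real.exp_zero,
      mul_zero, zero_sub, smul_eq_mul, inv_mul_eq_div]
  rw [intervalIntegral.integral_add (by simp) (Continuous.intervalIntegrable (by fun_prop) _ _),
    intervalIntegral.integral_const, hexp, sub_zero, smul_eq_mul, mul_comm T]
  gcongr
  exact sub_le_self _ (Real.exp_pos _).le

-- A centred variable that exceeds `T` with high probability has a large negative part.
lemma mul_sub_inv_le_meanNeg (hp : 0 ≤ p) (hp1 : ∑ i, p i = 1) (hmean : ∑ i, p i * w i = 0)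
    {a c T : ℝ} (hc : 0 < c) (hT : 0 ≤ T) (h : ∀ t, cdf p w t ≤ a + Real.exp (c * (t - T))) :
    (1 - a) * T - 1 / c ≤ meanNeg p w := by
  have hint : ∫ t in (0 : ℝ)..T, cdf p w t ≤ ∫ t in (0 : ℝ)..T, (a + Real.exp (c * (t - T))) :=
    intervalIntegral.integral_mono_on hT (monotone_cdf hp).intervalIntegrable
      (Continuous.intervalIntegrable (by fun_prop) _ _) fun t _ => h t
  have hlow := sub_integral_cdf_le (w := w) hp hp1 hT
  rw [sum_mul_max_eq_meanNeg_add, hmean] at hlow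
  linarith [integral_add_exp_le a T hc]

end FiniteDistribution

section SubExponential

variable {κ : Type*} [Fintype κ]

/-- A centred random variable `w` on a finite set with weights `p`, whose exponential moments and
variance are controlled on the scale `N`. The numerical constants are those satisfied by a sum of
`n` independent copies of the log-likelihood ratio on the scale `√n log η`. -/
structure SubExp (p w : κ → ℝ) (N : ℝ) : Prop where
  nonneg : 0 ≤ p
  sum_eq_one : ∑ i, p i = 1
  mean : ∑ i, p i * w i = 0
  mgf : ∑ i, p i * Real.exp ((4 * N)⁻¹ * w i) ≤ Real.exp (9 / 32)
  mgf_neg : ∑ i, p i * Real.exp (-(4 * N)⁻¹ * w i) ≤ Real.exp (9 / 32)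
  var : ∑ i, p i * w i ^ 2 ≤ 4.01 * N ^ 2
  le_scale : 1.09 ≤ N

lemma mul_exp_neg_le (u : ℝ) : u * Real.exp (-u) ≤ 0.3679 := by
  calc u * Real.exp (-u) ≤ Real.exp (u - 1) * Real.exp (-u) :=
        mul_le_mul_of_nonneg_right (by linarith [Real.add_one_le_exp (u - 1)]) (Real.exp_pos _).le
    _ = Real.exp (-1) := by rw [← Real.exp_add, sub_add_eq_add_sub, add_neg_cancel, zero_sub]
    _ ≤ 0.3679 := by linarith [Real.exp_neg_one_lt_d9]

lemma le_neg_log {x : ℝ} (hx : 0 < x) : 2.386 - 4 * x ≤ -Real.log x := by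
  have hlog := Real.log_le_sub_one_of_pos (show 0 < 4 * x by linarith)
  have hfour : Real.log 4 = 2 * Real.log 2 := by
    rw [show (4 : ℝ) = 2 ^ 2 by norm_num, Real.log_pow]; norm_num
  rw [Real.log_mul (by norm_num) hx.ne', hfour] at hlog
  linarith [Real.log_two_gt_d9]

lemma le_neg_log_one_sub {x : ℝ} (hx : 1 / 4 ≤ x) (hx1 : x < 1) :
    9 / 32 ≤ -Real.log (1 - x) := by
  have hlog : Real.log (1 - x) ≤ Real.log (3 / 4) := Real.log_le_log (by linarith) (by linarith)
  rw [Real.log_div three_ne_zero four_ne_zero, show (4 : ℝ) = 2 ^ 2 by norm_num,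
    Real.log_pow] at hlog
  norm_num at hlog ⊢
  linarith [Real.log_two_gt_d9, Real.log_three_lt_d9]

namespace SubExp

variable {p w : κ → ℝ} {N : ℝ}

lemma neg (h : SubExp p w N) : SubExp p (-w) N where
  nonneg := h.nonneg
  sum_eq_one := h.sum_eq_one
  mean := by simp [h.mean]
  mgf := by simpa using h.mgf_neg
  mgf_neg := by simpa using h.mgf
  var := by simpa using h.var
  le_scale := h.le_scale

lemma scale_pos (h : SubExp p w N) : 0 < N := lt_of_lt_of_le (by norm_num) h.le_scale

lemma meanNeg_le_of_cdf_zero_le (h : SubExp p w N) {Q : ℝ} (hQ : 0 < Q) (hcdf : cdf p w 0 ≤ Q)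
    (hlog : Real.log Q ≤ 9 / 32 - 1) :
    meanNeg p w ≤ 4 * N * (Q * (9 / 32 - Real.log Q)) := by
  set b := 9 / 32 - Real.log Q with hb
  have hexp : Real.exp (9 / 32) * Real.exp (-b) = Q := by
    rw [← Real.exp_add, hb, neg_sub, add_sub_cancel, Real.exp_log hQ]
  rw [← inv_mul_le_iff₀ (mul_pos four_pos h.scale_pos)]
  calc (4 * N)⁻¹ * meanNeg p w
      ≤ (∑ i, p i * Real.exp (-(4 * N)⁻¹ * w i)) * Real.exp (-b) + (b - 1) * cdf p w 0 :=
        mul_meanNeg_le_mgf_mul_exp_add h.nonneg _ _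
    _ ≤ Real.exp (9 / 32) * Real.exp (-b) + (b - 1) * Q :=
        add_le_add (mul_le_mul_of_nonneg_right h.mgf_neg (Real.exp_pos _).le)
          (mul_le_mul_of_nonneg_left hcdf (by linarith))
    _ = Q * b := by rw [hexp]; ring

lemma le_cdf_of_quarter_le (h : SubExp p w N) {x τ : ℝ} (hx : 1 / 4 ≤ x) (hx1 : x < 1)
    (hτ : 8 * N * -Real.log (1 - x) ≤ τ) : x ≤ cdf p w τ := by
  have hN : 0 < 4 * N := mul_pos four_pos h.scale_pos
  have hle : 2 * -Real.log (1 - x) ≤ (4 * N)⁻¹ * τ := by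
    rw [inv_mul_eq_div, le_div_iff₀ hN]
    linarith
  have htail : Real.exp (9 / 32) * Real.exp (-((4 * N)⁻¹ * τ)) ≤ 1 - x := by
    rw [← Real.exp_add, ← Real.le_log_iff_exp_le (by linarith)]
    linarith [le_neg_log_one_sub hx hx1]
  have hchernoff := one_sub_mgf_mul_exp_le_cdf (w := w) h.nonneg h.sum_eq_one
    (inv_pos.mpr hN).le τ
  linarith [mul_le_mul_of_nonneg_right h.mgf (Real.exp_pos (-((4 * N)⁻¹ * τ))).le]

lemma mul_le_eight_mul (h : SubExp p w N) {c x : ℝ} (hc : 1 / 2 ≤ c) (hx : 0 ≤ x) :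
    4.36 * x ≤ 8 * c * (N * x) := by
  have hNx := mul_le_mul_of_nonneg_right h.le_scale hx
  nlinarith

lemma mul_meanNeg_le_of_cdf_zero_le_exp (h : SubExp p w N) {c x : ℝ} (hc : 1 / 2 ≤ c)
    (hx : 0 < x) (hx4 : x ≤ 1 / 4) (hcdf : cdf p w 0 ≤ 2 * (x * Real.exp (-(8 * c * (N * x))))) :
    c * meanNeg p w ≤ 0.3679 * (9 / 32 - Real.log 2 - Real.log x + 8 * c * (N * x)) := by
  set u := 8 * c * (N * x) with hu
  have hxu : 4.36 * x ≤ u := h.mul_le_eight_mul hc hx.le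
  have hpos : 0 < x * Real.exp (-u) := mul_pos hx (Real.exp_pos _)
  have hlog : Real.log (2 * (x * Real.exp (-u))) = Real.log 2 + Real.log x - u := by
    rw [Real.log_mul two_ne_zero hpos.ne', Real.log_mul hx.ne' (Real.exp_pos _).ne', Real.log_exp]
    ring
  have hlogx := le_neg_log hx
  have hlog2 := Real.log_two_lt_d9
  have hmean := h.meanNeg_le_of_cdf_zero_le (mul_pos two_pos hpos) hcdf (by rw [hlog]; linarith)
  calc c * meanNeg p w
      ≤ c * (4 * N * (2 * (x * Real.exp (-u)) * (9 / 32 - (Real.log 2 + Real.log x - u)))) := by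
        rw [← hlog]
        exact mul_le_mul_of_nonneg_left hmean (by linarith)
    _ = u * Real.exp (-u) * (9 / 32 - Real.log 2 - Real.log x + u) := by rw [hu]; ring
    _ ≤ _ := mul_le_mul_of_nonneg_right (mul_exp_neg_le u) (by linarith)

lemma meanNeg_le_of_cdf_zero_le_sq (h : SubExp p w N) {y : ℝ} (hy : 0 ≤ y)
    (hcdf : cdf p w 0 ≤ 2 * (2 * y) ^ 2) : meanNeg p w ≤ 5.67 * (N * y) := by
  have hNy : 0 ≤ N * y := mul_nonneg h.scale_pos.le hy
  refine (abs_le_of_sq_le_sq' ?_ (by positivity)).2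
  calc meanNeg p w ^ 2 ≤ cdf p w 0 * ∑ i, p i * w i ^ 2 := sq_meanNeg_le h.nonneg
    _ ≤ 2 * (2 * y) ^ 2 * (4.01 * N ^ 2) := mul_le_mul hcdf h.var
        (Finset.sum_nonneg fun i _ => mul_nonneg (h.nonneg i) (sq_nonneg _)) (by positivity)
    _ = 32.08 * (N * y) ^ 2 := by ring
    _ ≤ (5.67 * (N * y)) ^ 2 := by nlinarith [sq_nonneg (N * y)]

lemma mul_meanNeg_lt (h : SubExp p w N) {c x : ℝ} (hc : 1 / 2 ≤ c) (hc1 : c ≤ 1) (hx : 0 < x)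
    (hx4 : x ≤ 1 / 4)
    (hcdf : cdf p w 0 ≤ (2 * (c * x)) ^ 2 + x * Real.exp (-(8 * c * (N * x)))) :
    c * meanNeg p w < 3 / 4 * (8 * c * (N * x) - Real.log x) - 1 := by
  have hlogx := le_neg_log hx
  have hxu := h.mul_le_eight_mul hc hx.le
  rcases le_total ((2 * (c * x)) ^ 2) (x * Real.exp (-(8 * c * (N * x)))) with hexp | hsq
  · have := h.mul_meanNeg_le_of_cdf_zero_le_exp hc hx hx4 (by linarith)
    linarith [Real.log_two_gt_d9]
  · have hmean := h.meanNeg_le_of_cdf_zero_le_sq (y := c * x) (by positivity) (by linarith)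
    have hmul : c * meanNeg p w ≤ 5.67 * (c * (N * x)) := by
      have h0 : 0 ≤ N * (c * x) := mul_nonneg h.scale_pos.le (by positivity)
      nlinarith [h0]
    linarith

lemma exists_le_cdf_of_le_quarter (h : SubExp p w N) {c x : ℝ} (hc : 1 / 2 ≤ c) (hc1 : c ≤ 1)
    (hx : 0 < x) (hx4 : x ≤ 1 / 4) :
    ∃ t, (2 * (c * x)) ^ 2 ≤ cdf p w t ∧ x * Real.exp (c * (t - 8 * (N * x))) ≤ cdf p w t := by
  by_contra! hcon
  have hcdf : ∀ t, cdf p w t ≤ (2 * (c * x)) ^ 2 + x * Real.exp (c * (t - 8 * (N * x))) :=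
    fun t => by
      rcases lt_or_ge (cdf p w t) ((2 * (c * x)) ^ 2) with hlt | hge
      · exact le_add_of_le_of_nonneg hlt.le (by positivity)
      · exact le_add_of_nonneg_of_le (sq_nonneg _) (hcon t hge).le
  have hc0 : 0 < c := by linarith
  have hlogx := le_neg_log hx
  have hNx : 0 < N * x := mul_pos h.scale_pos hx
  set T := 8 * (N * x) - Real.log x / c with hT
  have hT0 : 0 ≤ T := by
    have : Real.log x / c ≤ 0 := div_nonpos_of_nonpos_of_nonneg (by linarith) hc0.le
    linarith
  have hcT : c * T = 8 * c * (N * x) - Real.log x := by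
    rw [hT, mul_sub, mul_div_cancel₀ _ hc0.ne']
    ring
  have hlower := mul_sub_inv_le_meanNeg (T := T) h.nonneg h.sum_eq_one h.mean hc0 hT0 fun t => by
    have hexp : x * Real.exp (c * (t - 8 * (N * x))) = Real.exp (c * (t - T)) := by
      rw [mul_sub c t T, hcT, ← Real.exp_log hx, ← Real.exp_add, Real.exp_log hx]
      ring_nf
    exact hexp ▸ hcdf t
  have hupper := h.mul_meanNeg_lt hc hc1 hx hx4 (by convert hcdf 0 using 4; ring)
  have hscaled := mul_le_mul_of_nonneg_left hlower hc0.le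
  rw [mul_sub, mul_one_div_cancel hc0.ne', mul_left_comm] at hscaled
  have hcx : c * x ≤ 1 / 4 := (mul_le_of_le_one_left hx.le hc1).trans hx4
  have hthree : 3 / 4 ≤ 1 - (2 * (c * x)) ^ 2 := by nlinarith [mul_pos hc0 hx]
  have := mul_le_mul_of_nonneg_right hthree (mul_nonneg hc0.le hT0)
  linarith

lemma le_cdf_or_exists_le_cdf (h : SubExp p w N) {c x τ : ℝ} (hc : 1 / 2 ≤ c) (hc1 : c ≤ 1)
    (hx : 0 < x) (hx1 : x < 1) (hτ : 8 * N * -Real.log (1 - x) ≤ τ) :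
    x ≤ cdf p w τ ∨
      ∃ t, (2 * (c * x)) ^ 2 ≤ cdf p w t ∧ x * Real.exp (c * (t - τ)) ≤ cdf p w t := by
  rcases le_total (1 / 4) x with hx4 | hx4
  · exact Or.inl (h.le_cdf_of_quarter_le hx4 hx1 hτ)
  obtain ⟨t, hsq, hexp⟩ := h.exists_le_cdf_of_le_quarter hc hc1 hx hx4
  have hle : 8 * (N * x) ≤ τ := by
    have hlog := Real.log_le_sub_one_of_pos (sub_pos.mpr hx1)
    have := mul_le_mul_of_nonneg_left (show x ≤ -Real.log (1 - x) by linarith) h.scale_pos.le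
    linarith
  exact Or.inr ⟨t, hsq, le_trans (by gcongr) hexp⟩

end SubExp

end SubExponential

/-! ### Exponential moments of sums of independent copies -/

section Cosh

lemma mul_cosh_mul_mul_sinh_le {β s : ℝ} (hβ : 0 ≤ β) (hβ1 : β ≤ 1) (hs : 0 ≤ s) :
    β * Real.cosh (β * s) * Real.sinh s ≤ Real.sinh (β * s) * Real.cosh s := by
  have hanti : AntitoneOn (fun s => β * Real.cosh (β * s) * Real.sinh s
      - Real.sinh (β * s) * Real.cosh s) (Set.Ici 0) := by
    refine antitoneOn_of_hasDerivWithinAt_nonpos (convex_Ici 0)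
      (f' := fun s => (β ^ 2 - 1) * (Real.sinh (β * s) * Real.sinh s)) (by fun_prop)
      (fun s _ => HasDerivAt.hasDerivWithinAt ?_) fun s hs => ?_
    · have hmul := hasDerivAt_const_mul (x := s) β
      refine (((hmul.cosh.const_mul β).mul (Real.hasDerivAt_sinh s)).sub
        (hmul.sinh.mul (Real.hasDerivAt_cosh s))).congr_deriv ?_
      ring
    · rw [interior_Ici, Set.mem_Ioi] at hs
      exact mul_nonpos_of_nonpos_of_nonneg (by nlinarith) (mul_nonneg
        (Real.sinh_nonneg_iff.mpr (mul_nonneg hβ hs.le)) (Real.sinh_nonneg_iff.mpr hs.le))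
  simpa using hanti (Set.mem_Ici.mpr le_rfl) (Set.mem_Ici.mpr hs) hs

lemma antitoneOn_sinh_mul_div_sinh {β : ℝ} (hβ : 0 ≤ β) (hβ1 : β ≤ 1) :
    AntitoneOn (fun s => Real.sinh (β * s) / Real.sinh s) (Set.Ioi 0) := by
  have hne : ∀ s ∈ Set.Ioi (0 : ℝ), Real.sinh s ≠ 0 := fun s hs => (Real.sinh_pos_iff.mpr hs).ne'
  refine antitoneOn_of_hasDerivWithinAt_nonpos (convex_Ioi 0)
    (f' := fun s => (β * Real.cosh (β * s) * Real.sinh s - Real.sinh (β * s) * Real.cosh s)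
      / Real.sinh s ^ 2) (ContinuousOn.div (by fun_prop) (by fun_prop) hne)
    (fun s hs => HasDerivAt.hasDerivWithinAt ?_) fun s hs => ?_
  · rw [interior_Ioi] at hs
    refine ((hasDerivAt_const_mul (x := s) β).sinh.div (Real.hasDerivAt_sinh s)
      (hne s hs)).congr_deriv ?_
    ring
  · rw [interior_Ioi] at hs
    exact div_nonpos_of_nonpos_of_nonneg
      (sub_nonpos.mpr (mul_cosh_mul_mul_sinh_le hβ hβ1 (le_of_lt hs))) (sq_nonneg _)

-- The tangent line inequality at `cosh l` for `cosh (β s)` as a concave function of `cosh s`.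
lemma cosh_mul_le {β l : ℝ} (hβ : 0 ≤ β) (hβ1 : β ≤ 1) (hl : 0 < l) (s : ℝ) :
    Real.cosh (β * s) ≤ Real.cosh (β * l)
      + β * (Real.sinh (β * l) / Real.sinh l) * (Real.cosh s - Real.cosh l) := by
  wlog hs : 0 ≤ s generalizing s
  · have := this (-s) (by linarith)
    rwa [mul_neg, Real.cosh_neg, Real.cosh_neg] at this
  have hanti := antitoneOn_sinh_mul_div_sinh hβ hβ1
  set k := Real.sinh (β * l) / Real.sinh l
  have hderiv : ∀ x, HasDerivAt (fun s => β * k * Real.cosh s - Real.cosh (β * s))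
      (β * (k * Real.sinh x - Real.sinh (β * x))) x := fun x => by
    refine (((Real.hasDerivAt_cosh x).const_mul (β * k)).sub
      (hasDerivAt_const_mul (x := x) β).cosh).congr_deriv ?_
    ring
  have hcont : Continuous fun s => β * k * Real.cosh s - Real.cosh (β * s) := by fun_prop
  suffices h : β * k * Real.cosh l - Real.cosh (β * l) ≤ β * k * Real.cosh s - Real.cosh (β * s) by
    linarith
  rcases le_total s l with h | h
  · refine antitoneOn_of_hasDerivWithinAt_nonpos (convex_Icc 0 l) hcont.continuousOn
      (fun x _ => (hderiv x).hasDerivWithinAt) (fun x hx => ?_) ⟨hs, h⟩ ⟨hl.le, le_rfl⟩ h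
    rw [interior_Icc] at hx
    have hratio : k ≤ Real.sinh (β * x) / Real.sinh x := hanti hx.1 hl hx.2.le
    rw [le_div_iff₀ (Real.sinh_pos_iff.mpr hx.1)] at hratio
    exact mul_nonpos_of_nonneg_of_nonpos hβ (sub_nonpos.mpr hratio)
  · refine monotoneOn_of_hasDerivWithinAt_nonneg (convex_Ici l) hcont.continuousOn
      (fun x _ => (hderiv x).hasDerivWithinAt) (fun x hx => ?_) (Set.mem_Ici.mpr le_rfl)
      (Set.mem_Ici.mpr h) h
    rw [interior_Ici] at hx
    have hx0 : 0 < x := hl.trans hx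
    have hratio : Real.sinh (β * x) / Real.sinh x ≤ k := hanti hl hx0 (le_of_lt hx)
    rw [div_le_iff₀ (Real.sinh_pos_iff.mpr hx0)] at hratio
    exact mul_nonneg hβ (sub_nonneg.mpr hratio)

lemma one_add_sq_div_two_le_cosh (u : ℝ) : 1 + u ^ 2 / 2 ≤ Real.cosh u := by
  have hsinh : |u| / 2 ≤ Real.sinh (|u| / 2) := Real.self_le_sinh_iff.mpr (by positivity)
  calc 1 + u ^ 2 / 2 = 1 + 2 * (|u| / 2) ^ 2 := by rw [div_pow, sq_abs]; ring
    _ ≤ 1 + 2 * Real.sinh (|u| / 2) ^ 2 := by gcongr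
    _ = Real.cosh u := by
        rw [← Real.cosh_abs u, ← mul_div_cancel₀ |u| (two_ne_zero' ℝ), Real.cosh_two_mul,
          Real.cosh_sq, mul_div_cancel₀ |u| (two_ne_zero' ℝ)]
        ring

lemma cosh_le_one_add {u : ℝ} (hu : u ^ 2 ≤ 2) :
    Real.cosh u ≤ 1 + u ^ 2 / 2 + (u ^ 2 / 2) ^ 2 := by
  have habs : |u ^ 2 / 2| ≤ 1 := by
    rw [abs_of_nonneg (by positivity)]
    linarith
  linarith [Real.cosh_le_exp_half_sq u, (abs_le.mp (Real.abs_exp_sub_one_sub_id_le habs)).2]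

lemma exp_le_add_two_mul_cosh_sub_one (u : ℝ) : Real.exp u ≤ u + 2 * Real.cosh u - 1 := by
  rw [Real.cosh_eq]
  linarith [Real.add_one_le_exp (-u)]

end Cosh

section Moments

variable {κ : Type*} [Fintype κ] {p X : κ → ℝ} {l β : ℝ}

lemma sum_mul_cosh_mul_le (hp : 0 ≤ p) (hp1 : ∑ i, p i = 1) (hl : 0 < l)
    (h : ∑ i, p i * Real.cosh (X i) ≤ Real.cosh l) (hβ : 0 ≤ β) (hβ1 : β ≤ 1) :
    ∑ i, p i * Real.cosh (β * X i) ≤ Real.cosh (β * l) := by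
  set k := β * (Real.sinh (β * l) / Real.sinh l)
  have hk0 : 0 ≤ k := mul_nonneg hβ (div_nonneg
    (Real.sinh_nonneg_iff.mpr (mul_nonneg hβ hl.le)) (Real.sinh_nonneg_iff.mpr hl.le))
  calc ∑ i, p i * Real.cosh (β * X i)
      ≤ ∑ i, p i * (Real.cosh (β * l) + k * (Real.cosh (X i) - Real.cosh l)) :=
        Finset.sum_le_sum fun i _ => mul_le_mul_of_nonneg_left (cosh_mul_le hβ hβ1 hl _) (hp i)
    _ = Real.cosh (β * l) + k * (∑ i, p i * Real.cosh (X i) - Real.cosh l) := by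
        simp only [mul_add, mul_sub, Finset.sum_add_distrib, Finset.sum_sub_distrib,
          mul_left_comm _ k, ← Finset.mul_sum, ← Finset.sum_mul, hp1, one_mul]
    _ ≤ Real.cosh (β * l) :=
        add_le_of_nonpos_right (mul_nonpos_of_nonneg_of_nonpos hk0 (sub_nonpos.mpr h))

lemma sum_mul_sq_le (hp : 0 ≤ p) (hp1 : ∑ i, p i = 1) (hl : 1 / 20 ≤ l)
    (h : ∑ i, p i * Real.cosh (X i) ≤ Real.cosh l) : ∑ i, p i * X i ^ 2 ≤ 1.0025 * l ^ 2 := by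
  have hl0 : 0 < l := by linarith
  set β := (20 * l)⁻¹ with hβ
  have hβ1 : β ≤ 1 := inv_le_one_of_one_le₀ (by linarith)
  have hβl : β * l = 1 / 20 := by rw [hβ, mul_inv, mul_assoc, inv_mul_cancel₀ hl0.ne']; norm_num
  have hcosh : 1 + β ^ 2 / 2 * ∑ i, p i * X i ^ 2 ≤ 1 + 1 / 800 + 1 / 640000 := by
    calc 1 + β ^ 2 / 2 * ∑ i, p i * X i ^ 2 = ∑ i, p i * (1 + (β * X i) ^ 2 / 2) := by
          simp only [mul_add, mul_one, Finset.sum_add_distrib, hp1, Finset.mul_sum]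
          exact congrArg _ (Finset.sum_congr rfl fun i _ => by ring)
      _ ≤ ∑ i, p i * Real.cosh (β * X i) := Finset.sum_le_sum fun i _ =>
          mul_le_mul_of_nonneg_left (one_add_sq_div_two_le_cosh _) (hp i)
      _ ≤ Real.cosh (1 / 20) := hβl ▸ sum_mul_cosh_mul_le hp hp1 hl0 h (by positivity) hβ1
      _ ≤ 1 + 1 / 800 + 1 / 640000 := (cosh_le_one_add (by norm_num)).trans (by norm_num)
  have hsum : β ^ 2 * ∑ i, p i * X i ^ 2 ≤ 1.0025 * (β * l) ^ 2 := by rw [hβl]; linarith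
  have hβ2 : 0 < β ^ 2 := by positivity
  refine le_of_mul_le_mul_left ?_ hβ2
  linarith

lemma sum_mul_exp_le (hp : 0 ≤ p) (hp1 : ∑ i, p i = 1) (hl : 0 < l)
    (h : ∑ i, p i * Real.cosh (X i) ≤ Real.cosh l) (hβ : 0 ≤ β) (hβ1 : β ≤ 1) :
    ∑ i, p i * Real.exp (β * (X i - ∑ j, p j * X j))
      ≤ Real.exp (2 * (Real.cosh (β * l) - 1)) := by
  set d := ∑ j, p j * X j with hd
  have hcosh := sum_mul_cosh_mul_le hp hp1 hl h hβ hβ1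
  have hmgf : ∑ i, p i * Real.exp (β * X i)
      ≤ Real.exp (β * d + 2 * (Real.cosh (β * l) - 1)) := by
    calc ∑ i, p i * Real.exp (β * X i)
        ≤ ∑ i, p i * (β * X i + 2 * Real.cosh (β * X i) - 1) := Finset.sum_le_sum fun i _ =>
          mul_le_mul_of_nonneg_left (exp_le_add_two_mul_cosh_sub_one _) (hp i)
      _ = β * d + 2 * ∑ i, p i * Real.cosh (β * X i) - 1 := by
          simp only [mul_add, mul_sub, mul_one, Finset.sum_add_distrib, Finset.sum_sub_distrib,
            hp1, hd, Finset.mul_sum, mul_left_comm]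
      _ ≤ (β * d + 2 * (Real.cosh (β * l) - 1)) + 1 := by linarith
      _ ≤ _ := Real.add_one_le_exp _
  calc ∑ i, p i * Real.exp (β * (X i - d))
      = (∑ i, p i * Real.exp (β * X i)) * Real.exp (-(β * d)) := by
        simp only [mul_sub β, sub_eq_add_neg (β * _), Real.exp_add, Finset.sum_mul, mul_assoc]
    _ ≤ Real.exp (β * d + 2 * (Real.cosh (β * l) - 1)) * Real.exp (-(β * d)) :=
        mul_le_mul_of_nonneg_right hmgf (Real.exp_pos _).le
    _ = _ := by rw [← Real.exp_add, add_right_comm, add_neg_cancel, zero_add]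

lemma sum_fin_succ_fun (n : ℕ) (f : (Fin (n + 1) → κ) → ℝ) :
    ∑ I, f I = ∑ a, ∑ I : Fin n → κ, f (Fin.cons a I) := by
  rw [← Fintype.sum_prod_type']
  exact (Fintype.sum_equiv (Fin.consEquiv fun _ => κ) _ _ fun _ => rfl).symm

lemma sum_prod_eq_one (hp1 : ∑ i, p i = 1) (n : ℕ) : ∑ I : Fin n → κ, ∏ k, p (I k) = 1 := by
  rw [← Fintype.sum_pow, hp1, one_pow]

lemma sum_prod_mul_exp_sum (p X : κ → ℝ) (n : ℕ) :
    ∑ I : Fin n → κ, (∏ k, p (I k)) * Real.exp (∑ k, X (I k))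
      = (∑ i, p i * Real.exp (X i)) ^ n := by
  simp only [Fintype.sum_pow, Finset.prod_mul_distrib, Real.exp_sum]

lemma sum_prod_mul_sum_eq_zero (hp1 : ∑ i, p i = 1) (hX : ∑ i, p i * X i = 0) (n : ℕ) :
    ∑ I : Fin n → κ, (∏ k, p (I k)) * ∑ k, X (I k) = 0 := by
  induction n with
  | zero => simp
  | succ n ih =>
    have hsplit : ∀ a (I : Fin n → κ), p a * (∏ k, p (I k)) * (X a + ∑ k, X (I k))
        = p a * X a * (∏ k, p (I k)) + p a * ((∏ k, p (I k)) * ∑ k, X (I k)) :=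
      fun _ _ => by ring
    simp only [sum_fin_succ_fun, Fin.prod_univ_succ, Fin.sum_univ_succ, Fin.cons_zero,
      Fin.cons_succ, hsplit, Finset.sum_add_distrib, ← Finset.mul_sum, sum_prod_eq_one hp1, ih,
      mul_one, mul_zero, hX, Finset.sum_const_zero, add_zero]

lemma sum_prod_mul_sum_sq (hp1 : ∑ i, p i = 1) (hX : ∑ i, p i * X i = 0) (n : ℕ) :
    ∑ I : Fin n → κ, (∏ k, p (I k)) * (∑ k, X (I k)) ^ 2 = n * ∑ i, p i * X i ^ 2 := by
  induction n with
  | zero => simp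
  | succ n ih =>
    have hsplit : ∀ a (I : Fin n → κ), p a * (∏ k, p (I k)) * (X a + ∑ k, X (I k)) ^ 2
        = p a * X a ^ 2 * (∏ k, p (I k)) + 2 * (p a * X a) * ((∏ k, p (I k)) * ∑ k, X (I k))
          + p a * ((∏ k, p (I k)) * (∑ k, X (I k)) ^ 2) := fun _ _ => by ring
    simp only [sum_fin_succ_fun, Fin.prod_univ_succ, Fin.sum_univ_succ, Fin.cons_zero,
      Fin.cons_succ, hsplit, Finset.sum_add_distrib, ← Finset.mul_sum, ← Finset.sum_mul,
      sum_prod_eq_one hp1, sum_prod_mul_sum_eq_zero hp1 hX, ih, mul_one, mul_zero,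
      Finset.sum_const_zero, add_zero, hp1]
    push_cast
    ring

lemma sum_mul_sub_mean_eq_zero (hp1 : ∑ i, p i = 1) (X : κ → ℝ) :
    ∑ i, p i * (X i - ∑ j, p j * X j) = 0 := by
  simp only [mul_sub, Finset.sum_sub_distrib, ← Finset.sum_mul, hp1, one_mul, sub_self]

lemma sum_mul_sub_mean_sq_le (hp1 : ∑ i, p i = 1) (X : κ → ℝ) :
    ∑ i, p i * (X i - ∑ j, p j * X j) ^ 2 ≤ ∑ i, p i * X i ^ 2 := by
  set d := ∑ j, p j * X j with hd
  have hexpand : ∀ i, p i * (X i - d) ^ 2 = p i * X i ^ 2 - 2 * d * (p i * X i) + p i * d ^ 2 :=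
    fun i => by ring
  simp only [hexpand, Finset.sum_add_distrib, Finset.sum_sub_distrib, ← Finset.mul_sum, ← hd,
    ← Finset.sum_mul, hp1]
  nlinarith [sq_nonneg d]

lemma sum_mul_exp_inv_mul_le (hp : 0 ≤ p) (hp1 : ∑ i, p i = 1) (hl : 1 ≤ l)
    (h : ∑ i, p i * Real.cosh (X i / 2) ≤ Real.cosh l) {n : ℕ} (hn : 1 ≤ n) :
    ∑ i, p i * Real.exp ((4 * (√n * l))⁻¹ * (X i - ∑ j, p j * X j)) ≤ Real.exp (9 / 32 / n) := by
  have hl0 : 0 < l := by linarith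
  have hn1 : (1 : ℝ) ≤ n := by exact_mod_cast hn
  have hsqrt : 1 ≤ √(n : ℝ) := Real.one_le_sqrt.mpr hn1
  set β := (2 * (√n * l))⁻¹ with hβ
  have hβ1 : β ≤ 1 := inv_le_one_of_one_le₀ (by nlinarith)
  have hβl : (β * l) ^ 2 = 1 / 4 / n := by
    rw [hβ, mul_pow, inv_pow, mul_pow, mul_pow, Real.sq_sqrt (by positivity)]
    field_simp
    norm_num
  have hquarter : (1 : ℝ) / 4 / n ≤ 1 / 4 := div_le_self (by norm_num) hn1
  have hcosh : Real.cosh (β * l) - 1 ≤ 9 / 64 / n := by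
    have hle := cosh_le_one_add (u := β * l) (by linarith)
    have hpos : 0 ≤ (1 : ℝ) / 4 / n := by positivity
    have hdiv : (9 : ℝ) / 64 / n = 9 / 16 * (1 / 4 / n) := by ring
    rw [hβl] at hle
    nlinarith
  have hdouble : (9 : ℝ) / 32 / n = 2 * (9 / 64 / n) := by ring
  calc ∑ i, p i * Real.exp ((4 * (√n * l))⁻¹ * (X i - ∑ j, p j * X j))
      = ∑ i, p i * Real.exp (β * (X i / 2 - ∑ j, p j * (X j / 2))) := by
        simp only [← mul_div_assoc, ← Finset.sum_div, ← sub_div, hβ]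
        refine Finset.sum_congr rfl fun i _ => ?_
        ring_nf
    _ ≤ Real.exp (2 * (Real.cosh (β * l) - 1)) :=
        sum_mul_exp_le hp hp1 hl0 h (by positivity) hβ1
    _ ≤ Real.exp (9 / 32 / n) := Real.exp_le_exp.mpr (by linarith)

lemma sum_prod_mul_exp_sum_le (hp : 0 ≤ p) {a : ℝ} {n : ℕ} (hn : n ≠ 0)
    (h : ∑ i, p i * Real.exp (X i) ≤ Real.exp (a / n)) :
    ∑ I : Fin n → κ, (∏ k, p (I k)) * Real.exp (∑ k, X (I k)) ≤ Real.exp a := by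
  rw [sum_prod_mul_exp_sum]
  refine (pow_le_pow_left₀ (Finset.sum_nonneg fun i _ =>
    mul_nonneg (hp i) (Real.exp_pos _).le) h n).trans_eq ?_
  rw [← Real.exp_nat_mul, mul_div_cancel₀ _ (Nat.cast_ne_zero.mpr hn)]

lemma subExp_sum (hp : 0 ≤ p) (hp1 : ∑ i, p i = 1) (hl : 1.09 ≤ l)
    (h : ∑ i, p i * Real.cosh (X i / 2) ≤ Real.cosh l) {n : ℕ} (hn : 1 ≤ n) :
    SubExp (fun I : Fin n → κ => ∏ k, p (I k)) (fun I => ∑ k, (X (I k) - ∑ j, p j * X j))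
      (√n * l) where
  nonneg I := Finset.prod_nonneg fun k _ => hp (I k)
  sum_eq_one := sum_prod_eq_one hp1 n
  mean := sum_prod_mul_sum_eq_zero hp1 (sum_mul_sub_mean_eq_zero hp1 X) n
  mgf := by
    simp only [Finset.mul_sum]
    exact sum_prod_mul_exp_sum_le (X := fun i => (4 * (√n * l))⁻¹ * (X i - ∑ j, p j * X j)) hp
      (by lia) (sum_mul_exp_inv_mul_le hp hp1 (by linarith) h hn)
  mgf_neg := by
    have hsign : ∀ i, -(4 * (√n * l))⁻¹ * (X i - ∑ j, p j * X j)
        = (4 * (√n * l))⁻¹ * ((-X) i - ∑ j, p j * (-X) j) := fun i => by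
      simp only [Pi.neg_apply, mul_neg, Finset.sum_neg_distrib]
      ring
    simp only [Finset.mul_sum, hsign]
    exact sum_prod_mul_exp_sum_le
      (X := fun i => (4 * (√n * l))⁻¹ * ((-X) i - ∑ j, p j * (-X) j)) hp (by lia)
      (sum_mul_exp_inv_mul_le hp hp1 (by linarith)
        (by simpa only [Pi.neg_apply, neg_div, Real.cosh_neg] using h) hn)
  var := by
    have hsq := sum_mul_sq_le hp hp1 (by linarith) h
    simp only [div_pow, ← mul_div_assoc, ← Finset.sum_div] at hsq
    rw [sum_prod_mul_sum_sq hp1 (sum_mul_sub_mean_eq_zero hp1 X), mul_pow,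
      Real.sq_sqrt (Nat.cast_nonneg n), mul_left_comm]
    exact mul_le_mul_of_nonneg_left (by linarith [sum_mul_sub_mean_sq_le hp1 X])
      (Nat.cast_nonneg n)
  le_scale := by
    have hsqrt : 1 ≤ √(n : ℝ) := Real.one_le_sqrt.mpr (by exact_mod_cast hn)
    nlinarith

lemma SubExp.comp_equiv {κ' : Type*} [Fintype κ'] {w : κ → ℝ} {N : ℝ} (h : SubExp p w N)
    (e : κ' ≃ κ) : SubExp (p ∘ e) (w ∘ e) N where
  nonneg i := h.nonneg (e i)
  sum_eq_one := (e.sum_comp p).trans h.sum_eq_one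
  mean := (e.sum_comp fun i => p i * w i).trans h.mean
  mgf := (e.sum_comp fun i => p i * Real.exp ((4 * N)⁻¹ * w i)).trans_le h.mgf
  mgf_neg := (e.sum_comp fun i => p i * Real.exp (-(4 * N)⁻¹ * w i)).trans_le h.mgf_neg
  var := (e.sum_comp fun i => p i * w i ^ 2).trans_le h.var
  le_scale := h.le_scale

lemma three_le_one_add_sum (hp : 0 ≤ p) (hp1 : ∑ i, p i = 1) :
    3 ≤ 1 + ∑ i, p i * (2 * Real.cosh (X i / 2)) := by
  have hsum : ∑ i, p i * 2 ≤ ∑ i, p i * (2 * Real.cosh (X i / 2)) :=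
    Finset.sum_le_sum fun i _ => mul_le_mul_of_nonneg_left
      (le_mul_of_one_le_right zero_le_two (Real.one_le_cosh _)) (hp i)
  rw [← Finset.sum_mul, hp1] at hsum
  linarith

lemma sum_mul_cosh_half_le_cosh_log {η : ℝ} (hη0 : 0 < η)
    (hη : η = 1 + ∑ i, p i * (2 * Real.cosh (X i / 2))) :
    ∑ i, p i * Real.cosh (X i / 2) ≤ Real.cosh (Real.log η) := by
  rw [Real.cosh_eq, Real.exp_neg, Real.exp_log hη0]
  simp only [mul_left_comm _ (2 : ℝ), ← Finset.mul_sum] at hη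
  linarith [inv_pos.mpr hη0]

lemma le_log_of_three_le {η : ℝ} (hη : 3 ≤ η) : 1.09 ≤ Real.log η :=
  (by linarith [Real.log_three_gt_d9] : (1.09 : ℝ) ≤ Real.log 3).trans
    (Real.log_le_log three_pos hη)

end Moments

/-! ### One-shot bounds for the smooth max-relative entropy -/

section DMaxSmooth

lemma two_rpow_div_log (x : ℝ) : (2 : ℝ) ^ (x / Real.log 2) = Real.exp x := by
  rw [Real.rpow_def_of_pos two_pos, mul_div_cancel₀ _ (Real.log_pos one_lt_two).ne']

lemma mem_ball_iff {ω ρ : Matrix ι ι ℂ} (hρ : IsState ρ) {ε : ℝ} (hε : 0 ≤ ε) :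
    ω ∈ ball ε ρ ↔ IsState ω ∧ √(1 - ε ^ 2) ≤ fidelity ω ρ := by
  refine and_congr_right fun hω => ?_
  rw [dOp, hω.2, hρ.2, Complex.one_re, Real.sqrt_le_left hε,
    Real.sqrt_le_left (fidelity_nonneg ω ρ)]
  constructor <;> intro h <;> linarith

variable {V W : unitaryGroup ι ℂ} {r s : ι → ℝ} {w : ι × ι → ℝ} {c : ℝ}

lemma cdf_le_commonMass (hr : 0 ≤ r) (hs : 0 ≤ s)
    (hlog : ∀ q, jointDist V W r q ≠ 0 → r q.1 = s q.2 * Real.exp (w q + c)) (t : ℝ) :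
    cdf (jointDist V W r) w t ≤ commonMass V W r (Real.exp (c + t) • s) := by
  rw [commonMass, ← Fintype.sum_prod_type', cdf, Finset.sum_filter]
  refine Finset.sum_le_sum fun q _ => ?_
  have hnonneg : 0 ≤ min (r q.1) (Real.exp (c + t) * s q.2) * overlap V W q.1 q.2 := mul_nonneg
    (le_min (hr _) (mul_nonneg (Real.exp_pos _).le (hs _))) (overlap_nonneg V W _ _)
  split_ifs with hq
  · by_cases hq0 : jointDist V W r q = 0
    · rwa [hq0]
    · refine mul_le_mul_of_nonneg_right (le_min le_rfl ?_) (overlap_nonneg V W _ _)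
      rw [hlog q hq0, mul_comm]
      exact mul_le_mul_of_nonneg_right (Real.exp_le_exp.mpr (by linarith)) (hs _)
  · exact hnonneg

lemma cdf_neg_le_sum (hr : 0 ≤ r) (hs : 0 ≤ s)
    (hlog : ∀ q, jointDist V W r q ≠ 0 → r q.1 = s q.2 * Real.exp (w q + c)) (t : ℝ) :
    cdf (jointDist V W r) (-w) t
      ≤ ∑ q with Real.exp (c - t) * s q.2 ≤ r q.1, jointDist V W r q := by
  rw [cdf, ← Finset.sum_filter_ne_zero]
  refine Finset.sum_le_sum_of_subset_of_nonneg (fun q hq => ?_)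
    fun q _ _ => jointDist_nonneg V W hr q
  simp only [Finset.mem_filter, Finset.mem_univ, true_and, Pi.neg_apply] at hq ⊢
  rw [hlog q hq.2, mul_comm]
  exact mul_le_mul_of_nonneg_left (Real.exp_le_exp.mpr (by linarith)) (hs _)

lemma dMaxSmooth_le_of_le_commonMass {ε u T : ℝ} (hr : 0 ≤ r) (hr1 : ∑ i, r i = 1) (hs : 0 ≤ s)
    (hs1 : ∑ j, s j = 1) (hT : 0 ≤ T) (hε : 0 ≤ ε)
    (hexp : √(1 - ε ^ 2) ≤ Real.exp ((T - u) / 2) * commonMass V W r (Real.exp u • s))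
    (hsqrt : √(1 - ε ^ 2) ≤ √(commonMass V W r (Real.exp u • s))) :
    dMaxSmooth ε (diagIn V r) (diagIn W s) ≤ ((T / Real.log 2 : ℝ) : EReal) := by
  have hscale : Real.exp (T - u) * Real.exp u = Real.exp T := by
    rw [← Real.exp_add, sub_add_cancel]
  obtain ⟨ω, hω, hωs, hF⟩ := exists_isState_le_smul_le_fidelity V W hr
    (smul_nonneg (Real.exp_pos u).le hs) (Real.exp_pos (T - u)) (by
      simp only [Pi.smul_apply, smul_eq_mul, ← Finset.mul_sum, hs1, mul_one, hscale]
      exact Real.one_le_exp hT)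
  rw [map_smul, smul_smul, hscale] at hωs
  rw [← Real.exp_half] at hF
  have hball : ω ∈ ball ε (diagIn V r) := (mem_ball_iff (isState_diagIn_iff.mpr ⟨hr, hr1⟩) hε).mpr
    ⟨hω, (le_min hexp hsqrt).trans hF⟩
  refine (iInf₂_le ω hball).trans (iInf₂_le (T / Real.log 2) ?_)
  rwa [two_rpow_div_log]

lemma dMaxSmooth_le {N τ ε : ℝ} (hr : 0 ≤ r) (hr1 : ∑ i, r i = 1) (hs : 0 ≤ s)
    (hs1 : ∑ j, s j = 1) (h : SubExp (jointDist V W r) w N)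
    (hlog : ∀ q, jointDist V W r q ≠ 0 → r q.1 = s q.2 * Real.exp (w q + c))
    (hcτ : 0 ≤ c + τ) (hε0 : 0 < ε) (hε1 : ε < 1)
    (hτ : 8 * N * -Real.log (1 - √(1 - ε ^ 2)) ≤ τ) :
    dMaxSmooth ε (diagIn V r) (diagIn W s) ≤ (((c + τ) / Real.log 2 : ℝ) : EReal) := by
  set x := √(1 - ε ^ 2)
  have hx0 : 0 < x := Real.sqrt_pos.mpr (by nlinarith)
  have hx1 : x < 1 := (Real.sqrt_lt' one_pos).mpr (by nlinarith)
  obtain ⟨t, hcdf, hcdf2⟩ : ∃ t, x ≤ Real.exp ((τ - t) / 2) * cdf (jointDist V W r) w t ∧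
      x ^ 2 ≤ cdf (jointDist V W r) w t := by
    rcases h.le_cdf_or_exists_le_cdf (c := 1 / 2) le_rfl (by norm_num) hx0 hx1 hτ with
      hle | ⟨t, hsq, hexp⟩
    · exact ⟨τ, by rwa [sub_self, zero_div, Real.exp_zero, one_mul], by nlinarith⟩
    · refine ⟨t, ?_, by linarith⟩
      calc x = Real.exp ((τ - t) / 2) * (x * Real.exp (1 / 2 * (t - τ))) := by
            rw [mul_left_comm, ← Real.exp_add, show (τ - t) / 2 + 1 / 2 * (t - τ) = 0 by ring,
              Real.exp_zero, mul_one]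
        _ ≤ _ := mul_le_mul_of_nonneg_left hexp (Real.exp_pos _).le
  have hmass := cdf_le_commonMass hr hs hlog t
  refine dMaxSmooth_le_of_le_commonMass (u := c + t) hr hr1 hs hs1 hcτ hε0.le ?_
    (Real.le_sqrt_of_sq_le (hcdf2.trans hmass))
  rw [add_sub_add_left_eq_sub]
  exact hcdf.trans (mul_le_mul_of_nonneg_left hmass (Real.exp_pos _).le)

section Rotation

variable {a a' b b' ε : ℝ}

-- With `(a', a) = (cos α, sin α)` and `(b', b) = (cos β, sin β)` this reads
-- `sin (β - α) ≤ ε` if `cos (β - α) ≥ √(1 - ε ^ 2)`.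
lemma mul_sub_mul_le_of_sqrt_le (ha : a ^ 2 + a' ^ 2 = 1) (hb : b ^ 2 + b' ^ 2 = 1) (hε : 0 ≤ ε)
    (h : √(1 - ε ^ 2) ≤ a * b + a' * b') : b * a' - a * b' ≤ ε := by
  refine (abs_le_of_sq_le_sq' ?_ hε).2
  have hsq := (Real.sqrt_le_iff.mp h).2
  have hpyth : (a * b + a' * b') ^ 2 + (b * a' - a * b') ^ 2 = 1 := by
    calc _ = (a ^ 2 + a' ^ 2) * (b ^ 2 + b' ^ 2) := by ring
      _ = 1 := by rw [ha, hb, one_mul]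
  linarith

lemma sq_sub_sq_le_of_sqrt_le (ha : a ^ 2 + a' ^ 2 = 1) (hb : b ^ 2 + b' ^ 2 = 1) (ha0 : 0 ≤ a)
    (ha0' : 0 ≤ a') (hb0 : 0 ≤ b) (hb0' : 0 ≤ b') (hε : 0 ≤ ε)
    (h : √(1 - ε ^ 2) ≤ a * b + a' * b') : b ^ 2 - a ^ 2 ≤ ε := by
  have hsin_add : b * a' + a * b' ≤ 1 := by
    nlinarith [sq_nonneg (b - a'), sq_nonneg (a - b')]
  calc b ^ 2 - a ^ 2 = b ^ 2 * (a ^ 2 + a' ^ 2) - a ^ 2 * (b ^ 2 + b' ^ 2) := by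
        rw [ha, hb, mul_one, mul_one]
    _ = (b * a' - a * b') * (b * a' + a * b') := by ring
    _ ≤ ε * 1 := mul_le_mul (mul_sub_mul_le_of_sqrt_le ha hb hε h) hsin_add (by positivity) hε
    _ = ε := mul_one ε

lemma sub_le_of_sqrt_le (ha : a ^ 2 + a' ^ 2 = 1) (hb : b ^ 2 + b' ^ 2 = 1) (ha0 : 0 ≤ a)
    (ha0' : 0 ≤ a') (hε : 0 ≤ ε) (h : √(1 - ε ^ 2) ≤ a * b + a' * b') : b - a ≤ ε := by
  have hcos : a * b + a' * b' ≤ 1 := by nlinarith [sq_nonneg (a - b), sq_nonneg (a' - b')]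
  have ha1' : a' ≤ 1 := by nlinarith
  have hsin := mul_sub_mul_le_of_sqrt_le ha hb hε h
  calc b - a = b * (a ^ 2 + a' ^ 2) - a := by rw [ha, mul_one]
    _ = (b * a' - a * b') * a' + (a * b + a' * b' - 1) * a := by ring
    _ ≤ ε * a' + 0 * a := by gcongr; linarith
    _ = ε * a' := by ring
    _ ≤ ε := mul_le_of_le_one_right hε ha1'

end Rotation

lemma exists_le_of_mem_ball {ω : Matrix ι ι ℂ} {M ε : ℝ} (hr : 0 ≤ r) (hr1 : ∑ i, r i = 1)
    (hs : 0 ≤ s)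
    (hlog : ∀ q, jointDist V W r q ≠ 0 → r q.1 = s q.2 * Real.exp (w q + c)) (hε : 0 ≤ ε)
    (hω : ω ∈ ball ε (diagIn V r)) (hM : 0 < M) (hle : ω ≤ M • diagIn W s) (t : ℝ) :
    ∃ a, 0 ≤ a ∧ Real.exp (c - t) * a ≤ M ∧ cdf (jointDist V W r) (-w) t - ε ≤ a ∧
      √(cdf (jointDist V W r) (-w) t) - ε ≤ √a := by
  obtain ⟨hωstate, hfid⟩ := (mem_ball_iff (isState_diagIn_iff.mpr ⟨hr, hr1⟩) hε).mp hω
  have hsum : ∑ q, jointDist V W r q = 1 := (sum_jointDist V W r).trans hr1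
  set S : Finset (ι × ι) := {q | Real.exp (c - t) * s q.2 ≤ r q.1}
  have hcdf : cdf (jointDist V W r) (-w) t ≤ ∑ q ∈ S, jointDist V W r q :=
    cdf_neg_le_sum hr hs hlog t
  obtain ⟨a, ha, ha1, haM, hF⟩ := exists_fidelity_le_binary V W hr hr1
    (smul_nonneg hM.le hs) hωstate (by rwa [map_smul]) (c := Real.exp (c - t) / M) (S := S)
    fun q hq => by
      rw [Pi.smul_apply, smul_eq_mul, ← mul_assoc, div_mul_cancel₀ _ hM.ne']
      exact (Finset.mem_filter.mp hq).2
  rw [div_mul_eq_mul_div, div_le_one hM] at haM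
  set b := ∑ q ∈ S, jointDist V W r q
  have hb : 0 ≤ b := Finset.sum_nonneg fun q _ => jointDist_nonneg V W hr q
  have hb1 : b ≤ 1 :=
    (Finset.sum_le_univ_sum_of_nonneg fun q => jointDist_nonneg V W hr q).trans_eq hsum
  have hpyth : ∀ {y : ℝ}, 0 ≤ y → y ≤ 1 → √y ^ 2 + √(1 - y) ^ 2 = 1 := fun hy hy1 => by
    rw [Real.sq_sqrt hy, Real.sq_sqrt (sub_nonneg.mpr hy1), add_sub_cancel]
  have hsq := sq_sub_sq_le_of_sqrt_le (hpyth ha ha1) (hpyth hb hb1) (Real.sqrt_nonneg _)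
    (Real.sqrt_nonneg _) (Real.sqrt_nonneg _) (Real.sqrt_nonneg _) hε (hfid.trans hF)
  have hlin := sub_le_of_sqrt_le (hpyth ha ha1) (hpyth hb hb1) (Real.sqrt_nonneg _)
    (Real.sqrt_nonneg _) hε (hfid.trans hF)
  rw [Real.sq_sqrt ha, Real.sq_sqrt hb] at hsq
  exact ⟨a, ha, haM, by linarith, by linarith [Real.sqrt_le_sqrt hcdf]⟩

lemma sub_mul_le_of_sqrt_sub_le {a f x E ε : ℝ} (ha : 0 ≤ a) (hε : 0 ≤ ε) (hεx : ε < x)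
    (hf : (2 * x) ^ 2 ≤ f) (hE : x * E ≤ f) (hfa : √f - ε ≤ √a) : (x - ε) * E ≤ a := by
  have hx : 0 < x := hε.trans_lt hεx
  have hf0 : 0 ≤ f := (sq_nonneg _).trans hf
  have hxf : 2 * x ≤ √f := Real.le_sqrt_of_sq_le hf
  have hmul : x * ((x - ε) * E) ≤ x * (√f - ε) ^ 2 := by
    calc x * ((x - ε) * E) = (x - ε) * (x * E) := by ring
      _ ≤ (x - ε) * √f ^ 2 := by
          rw [Real.sq_sqrt hf0]
          exact mul_le_mul_of_nonneg_left hE (by linarith)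
      _ = x * (√f - ε) ^ 2 - ε * √f * (√f - 2 * x) - x * ε ^ 2 := by ring
      _ ≤ x * (√f - ε) ^ 2 := by
          have hcross : 0 ≤ ε * √f * (√f - 2 * x) :=
            mul_nonneg (mul_nonneg hε (Real.sqrt_nonneg f)) (by linarith)
          have hrest : 0 ≤ x * ε ^ 2 := by positivity
          linarith
  calc (x - ε) * E ≤ (√f - ε) ^ 2 := le_of_mul_le_mul_left hmul hx
    _ ≤ √a ^ 2 := pow_le_pow_left₀ (by linarith) hfa 2
    _ = a := Real.sq_sqrt ha

lemma le_dMaxSmooth {N τ ε x : ℝ} (hr : 0 ≤ r) (hr1 : ∑ i, r i = 1) (hs : 0 ≤ s)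
    (h : SubExp (jointDist V W r) w N)
    (hlog : ∀ q, jointDist V W r q ≠ 0 → r q.1 = s q.2 * Real.exp (w q + c))
    (hε : 0 < ε) (hεx : ε < x) (hx1 : x < 1) (hτ : 8 * N * -Real.log (1 - x) ≤ τ) :
    (((c - τ + Real.log (x - ε)) / Real.log 2 : ℝ) : EReal)
      ≤ dMaxSmooth ε (diagIn V r) (diagIn W s) := by
  refine le_iInf₂ fun ω hω => le_iInf₂ fun γ hγ => ?_
  have hM := Real.rpow_pos_of_pos two_pos γ
  suffices hkey : Real.exp (c - τ) * (x - ε) ≤ 2 ^ γ by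
    have hlogle := Real.log_le_log (mul_pos (Real.exp_pos _) (sub_pos.mpr hεx)) hkey
    rw [Real.log_rpow two_pos, Real.log_mul (Real.exp_pos _).ne' (sub_pos.mpr hεx).ne',
      Real.log_exp] at hlogle
    rwa [EReal.coe_le_coe_iff, div_le_iff₀ (Real.log_pos one_lt_two)]
  have hbound := exists_le_of_mem_ball hr hr1 hs hlog hε.le hω hM hγ
  rcases h.neg.le_cdf_or_exists_le_cdf (c := 1) (by norm_num) le_rfl (hε.trans hεx) hx1 hτ with
    hle | ⟨t, hsq, hexp⟩
  · obtain ⟨a, -, haM, hcdf, -⟩ := hbound τ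
    exact (mul_le_mul_of_nonneg_left (by linarith) (Real.exp_pos _).le).trans haM
  · obtain ⟨a, ha, haM, -, hcdf⟩ := hbound t
    rw [one_mul] at hsq hexp
    calc Real.exp (c - τ) * (x - ε) = Real.exp (c - t) * ((x - ε) * Real.exp (t - τ)) := by
          rw [mul_left_comm, ← Real.exp_add, sub_add_sub_cancel, mul_comm]
      _ ≤ Real.exp (c - t) * a := mul_le_mul_of_nonneg_left
          (sub_mul_le_of_sqrt_sub_le ha hε.le hεx hsq hexp hcdf) (Real.exp_pos _).le
      _ ≤ 2 ^ γ := haM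

end DMaxSmooth

/-! ### The log-likelihood ratio of the eigenvalues of two states -/

section LogRatio

lemma mul_eq_zero_of_supp_le {n : Type*} [Fintype n] {A B P : Matrix n n ℂ}
    (h : supp A ≤ supp B) (hPB : P * B = 0) : P * A = 0 := by
  classical
  refine ext_of_mulVec_single fun i => ?_
  obtain ⟨x, hx⟩ := h ⟨Pi.single i 1, rfl⟩
  rw [mulVecLin_apply, mulVecLin_apply] at hx
  rw [← mulVec_mulVec, ← hx, mulVec_mulVec, hPB, zero_mulVec, zero_mulVec]

/-- The log-likelihood ratio `log rᵢ - log sⱼ` of two families of eigenvalues. -/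
def logRatio {κ : Type*} (r s : κ → ℝ) (q : κ × κ) : ℝ := Real.log (r q.1) - Real.log (s q.2)

lemma eq_mul_exp_logRatio {κ : Type*} {r s : κ → ℝ} {q : κ × κ} (hr : 0 < r q.1) (hs : 0 < s q.2) :
    r q.1 = s q.2 * Real.exp (logRatio r s q) := by
  rw [logRatio, Real.exp_sub, Real.exp_log hr, Real.exp_log hs, mul_div_cancel₀ _ hs.ne']

variable {V W : unitaryGroup ι ℂ} {r s : ι → ℝ}

lemma jointDist_eq_zero_of_supp_le (hr : 0 ≤ r) (h : supp (diagIn V r) ≤ supp (diagIn W s))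
    {q : ι × ι} (hq : s q.2 = 0) : jointDist V W r q = 0 := by
  have hsingle : Pi.single q.2 1 * s = 0 := by
    rw [← Pi.single_mul_left, hq, mul_zero, Pi.single_zero]
  have hproj : diagIn W (Pi.single q.2 1) * diagIn V r = 0 :=
    mul_eq_zero_of_supp_le h (by rw [← map_mul, hsingle, map_zero])
  have hsum : ∑ i, r i * overlap V W i q.2 = 0 := by
    have htrace := trace_diagIn_mul_diagIn V W r (Pi.single q.2 1)
    rw [trace_mul_comm, hproj, trace_zero, Complex.zero_re] at htrace
    simpa [Pi.single_apply] using htrace.symm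
  exact (Finset.sum_eq_zero_iff_of_nonneg fun i _ =>
    mul_nonneg (hr i) (overlap_nonneg V W i q.2)).mp hsum q.1 (Finset.mem_univ _)

lemma pos_of_jointDist_ne_zero (hr : 0 ≤ r) (hs : 0 ≤ s)
    (h : supp (diagIn V r) ≤ supp (diagIn W s)) {q : ι × ι} (hq : jointDist V W r q ≠ 0) :
    0 < r q.1 ∧ 0 < s q.2 :=
  ⟨(hr q.1).lt_of_ne' (left_ne_zero_of_mul hq),
    (hs q.2).lt_of_ne' fun hs0 => hq (jointDist_eq_zero_of_supp_le hr h hs0)⟩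

/-- The relative entropy of two states in nats, as the mean of the log-likelihood ratio of their
eigenvalues. -/
def meanLogRatio (V W : unitaryGroup ι ℂ) (r s : ι → ℝ) : ℝ :=
  ∑ q, jointDist V W r q * logRatio r s q

lemma relEntropy_diagIn (h : supp (diagIn V r) ≤ supp (diagIn W s)) :
    relEntropy (diagIn V r) (diagIn W s)
      = ((meanLogRatio V W r s / Real.log 2 : ℝ) : EReal) := by
  rw [relEntropy, if_pos h, matLog, matLog, cfc_diagIn, cfc_diagIn, Matrix.mul_sub, trace_sub,
    Complex.sub_re, ← map_mul, trace_diagIn, Complex.ofReal_re, trace_diagIn_mul_diagIn,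
    meanLogRatio, Fintype.sum_prod_type, Finset.sum_div, ← Finset.sum_sub_distrib]
  refine congrArg _ (Finset.sum_congr rfl fun i _ => ?_)
  rw [← mul_one ((r * (Real.logb 2 ∘ r)) i), ← sum_overlap_right V W i, Finset.mul_sum,
    ← Finset.sum_sub_distrib, Finset.sum_div]
  refine Finset.sum_congr rfl fun j _ => ?_
  simp only [Pi.mul_apply, Function.comp_apply, jointDist, logRatio, Real.logb]
  ring

lemma meanLogRatio_nonneg (hr : 0 ≤ r) (hr1 : ∑ i, r i = 1) (hs : 0 ≤ s) (hs1 : ∑ j, s j = 1)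
    (h : supp (diagIn V r) ≤ supp (diagIn W s)) : 0 ≤ meanLogRatio V W r s := by
  have hpoint : ∀ q, jointDist V W r q - s q.2 * overlap V W q.1 q.2
      ≤ jointDist V W r q * logRatio r s q := fun q => by
    by_cases hq : jointDist V W r q = 0
    · rw [hq, zero_mul, zero_sub, neg_nonpos]
      exact mul_nonneg (hs q.2) (overlap_nonneg V W q.1 q.2)
    · obtain ⟨hr0, hs0⟩ := pos_of_jointDist_ne_zero hr hs h hq
      have hs_eq : s q.2 = r q.1 * Real.exp (-logRatio r s q) := by
        rw [Real.exp_neg, ← div_eq_mul_inv, eq_div_iff (Real.exp_pos _).ne']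
        exact (eq_mul_exp_logRatio hr0 hs0).symm
      have hexp := mul_le_mul_of_nonneg_left (Real.add_one_le_exp (-logRatio r s q))
        (jointDist_nonneg V W hr q)
      have hmul : s q.2 * overlap V W q.1 q.2
          = jointDist V W r q * Real.exp (-logRatio r s q) := by
        rw [hs_eq, jointDist, mul_right_comm]
      linarith
  have hs_sum : ∑ q : ι × ι, s q.2 * overlap V W q.1 q.2 = 1 := by
    simp only [Fintype.sum_prod_type_right, ← Finset.mul_sum, sum_overlap_left, mul_one, hs1]
  have hsum := Finset.sum_le_sum fun q (_ : q ∈ Finset.univ) => hpoint q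
  rwa [Finset.sum_sub_distrib, sum_jointDist, hr1, hs_sum, sub_self] at hsum

lemma rpow_mul_rpow_eq_mul_exp {x y : ℝ} (hx : 0 < x) (hy : 0 < y) (a : ℝ) :
    x ^ (1 + a) * y ^ (-a) = x * Real.exp (a * (Real.log x - Real.log y)) := by
  rw [Real.rpow_add hx, Real.rpow_one, mul_assoc, Real.rpow_def_of_pos hx,
    Real.rpow_def_of_pos hy, ← Real.exp_add]
  ring_nf

lemma eta_diagIn (hr : 0 ≤ r) (hs : 0 ≤ s) (h : supp (diagIn V r) ≤ supp (diagIn W s)) :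
    eta (diagIn V r) (diagIn W s)
      = 1 + ∑ q, jointDist V W r q * (2 * Real.cosh (logRatio r s q / 2)) := by
  simp only [eta, rpow_diagIn V hr, rpow_diagIn W hs, trace_diagIn_mul_diagIn, add_assoc]
  simp only [← Finset.sum_add_distrib, ← add_mul, Fintype.sum_prod_type]
  refine congrArg _ (Finset.sum_congr rfl fun i _ => Finset.sum_congr rfl fun j _ => ?_)
  by_cases hq : jointDist V W r (i, j) = 0
  · rw [hq, zero_mul]
    rcases mul_eq_zero.mp hq with hr0 | hoverlap
    · rw [show r i = 0 from hr0, Real.zero_rpow (by norm_num), Real.zero_rpow (by norm_num)]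
      ring
    · rw [show overlap V W i j = 0 from hoverlap, mul_zero]
  · obtain ⟨hr0, hs0⟩ := pos_of_jointDist_ne_zero hr hs h hq
    have hplus := rpow_mul_rpow_eq_mul_exp hr0 hs0 (1 / 2)
    have hminus := rpow_mul_rpow_eq_mul_exp hr0 hs0 (-1 / 2)
    norm_num at hplus hminus ⊢
    rw [hplus, hminus, jointDist, logRatio, Real.cosh_eq]
    ring_nf

end LogRatio

/-! ### The asymptotic equipartition property -/

section TensorPower

variable {V W : unitaryGroup ι ℂ} {r s : ι → ℝ}

lemma jointDist_tensorPowUnitary (V W : unitaryGroup ι ℂ) (r : ι → ℝ) (n : ℕ)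
    (q : (Fin n → ι) × (Fin n → ι)) :
    jointDist (tensorPowUnitary V n) (tensorPowUnitary W n) (fun I => ∏ k, r (I k)) q
      = ∏ k, jointDist V W r (q.1 k, q.2 k) := by
  simp only [jointDist, overlap_tensorPowUnitary, Finset.prod_mul_distrib]

/-- The centred log-likelihood ratio of the eigenvalues of `n` copies of two states. -/
def centredLogRatio (V W : unitaryGroup ι ℂ) (r s : ι → ℝ) {n : ℕ}
    (q : (Fin n → ι) × (Fin n → ι)) : ℝ :=
  ∑ k, (logRatio r s (q.1 k, q.2 k) - meanLogRatio V W r s)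

lemma subExp_tensorPow (hr : 0 ≤ r) (hr1 : ∑ i, r i = 1) (hs : 0 ≤ s)
    (h : supp (diagIn V r) ≤ supp (diagIn W s)) {n : ℕ} (hn : 1 ≤ n) :
    SubExp (jointDist (tensorPowUnitary V n) (tensorPowUnitary W n) fun I => ∏ k, r (I k))
      (centredLogRatio V W r s) (√n * Real.log (eta (diagIn V r) (diagIn W s))) := by
  have hp := jointDist_nonneg V W hr
  have hp1 : ∑ q, jointDist V W r q = 1 := (sum_jointDist V W r).trans hr1
  have hη := eta_diagIn hr hs h
  have hη3 := (three_le_one_add_sum (X := logRatio r s) hp hp1).trans_eq hη.symm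
  have hsub := subExp_sum hp hp1 (le_log_of_three_le hη3)
    (sum_mul_cosh_half_le_cosh_log (by linarith) hη) hn
  convert! hsub.comp_equiv
    (Equiv.arrowProdEquivProdArrow (Fin n) (fun _ => ι) fun _ => ι).symm using 1
  exact funext fun q => jointDist_tensorPowUnitary V W r n q

lemma prod_eq_mul_exp_centredLogRatio (hr : 0 ≤ r) (hs : 0 ≤ s)
    (h : supp (diagIn V r) ≤ supp (diagIn W s)) {n : ℕ} {q : (Fin n → ι) × (Fin n → ι)}
    (hq : jointDist (tensorPowUnitary V n) (tensorPowUnitary W n) (fun I => ∏ k, r (I k)) q ≠ 0) :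
    ∏ k, r (q.1 k) = (∏ k, s (q.2 k))
      * Real.exp (centredLogRatio V W r s q + n * meanLogRatio V W r s) := by
  rw [jointDist_tensorPowUnitary, Finset.prod_ne_zero_iff] at hq
  have hsum : centredLogRatio V W r s q + n * meanLogRatio V W r s
      = ∑ k, logRatio r s (q.1 k, q.2 k) := by
    rw [centredLogRatio, Finset.sum_sub_distrib, Finset.sum_const, Finset.card_univ,
      Fintype.card_fin, nsmul_eq_mul, sub_add_cancel]
  rw [hsum, Real.exp_sum, ← Finset.prod_mul_distrib]
  refine Finset.prod_congr rfl fun k hk => ?_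
  obtain ⟨hr0, hs0⟩ := pos_of_jointDist_ne_zero hr hs h (hq k hk)
  exact eq_mul_exp_logRatio hr0 hs0

end TensorPower

section FiniteSize

lemma eight_le_four_mul_sqrt_two_div_log_two : 8 ≤ 4 * √2 / Real.log 2 := by
  have hlog := Real.log_two_lt_d9
  have hsqrt : (1.4 : ℝ) ≤ √2 := Real.le_sqrt_of_sq_le (by norm_num)
  rw [le_div_iff₀ (Real.log_pos one_lt_two)]
  linarith

lemma sqrt_mul_log_mul_log_le {N η x : ℝ} (hη : 1 ≤ η) (hx : 0 ≤ x) (hx1 : x < 1) :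
    0 ≤ √N * (4 * √2) * Real.logb 2 η * Real.logb 2 ((1 - x)⁻¹) * Real.log 2 ∧
      8 * (√N * Real.log η) * -Real.log (1 - x)
        ≤ √N * (4 * √2) * Real.logb 2 η * Real.logb 2 ((1 - x)⁻¹) * Real.log 2 := by
  have hlogη := Real.log_nonneg hη
  have hlogx : 0 ≤ -Real.log (1 - x) :=
    neg_nonneg.mpr (Real.log_nonpos (by linarith) (by linarith))
  have heq : √N * (4 * √2) * Real.logb 2 η * Real.logb 2 ((1 - x)⁻¹) * Real.log 2
      = 4 * √2 / Real.log 2 * (√N * Real.log η) * -Real.log (1 - x) := by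
    simp only [Real.logb, Real.log_inv]
    field_simp
  rw [heq]
  exact ⟨by positivity, by gcongr; exact eight_le_four_mul_sqrt_two_div_log_two⟩

lemma prod_comp_nonneg {κ : Type*} {r : κ → ℝ} (hr : 0 ≤ r) (n : ℕ) :
    0 ≤ fun I : Fin n → κ => ∏ k, r (I k) :=
  fun I => Finset.prod_nonneg fun k _ => hr (I k)

variable {V W : unitaryGroup ι ℂ} {r s : ι → ℝ}

lemma one_le_eta_diagIn (hr : 0 ≤ r) (hs : 0 ≤ s) (h : supp (diagIn V r) ≤ supp (diagIn W s)) :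
    1 ≤ eta (diagIn V r) (diagIn W s) := by
  rw [eta_diagIn hr hs h, le_add_iff_nonneg_right]
  exact Finset.sum_nonneg fun q _ => mul_nonneg (jointDist_nonneg V W hr q)
    (mul_nonneg zero_le_two (Real.cosh_pos _).le)

lemma dMaxSmooth_tensorPow_diagIn_le (hr : 0 ≤ r) (hr1 : ∑ i, r i = 1) (hs : 0 ≤ s)
    (hs1 : ∑ j, s j = 1) (h : supp (diagIn V r) ≤ supp (diagIn W s)) {ε : ℝ} (hε0 : 0 < ε)
    (hε1 : ε < 1) {n : ℕ} (hn : 1 ≤ n) :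
    dMaxSmooth ε (tensorPow (diagIn V r) n) (tensorPow (diagIn W s) n)
      ≤ ((n * (meanLogRatio V W r s / Real.log 2)
          + √n * (4 * √2) * Real.logb 2 (eta (diagIn V r) (diagIn W s))
            * Real.logb 2 ((1 - √(1 - ε ^ 2))⁻¹) : ℝ) : EReal) := by
  have hF1 : √(1 - ε ^ 2) < 1 := by
    rw [Real.sqrt_lt' one_pos]
    nlinarith
  obtain ⟨hτ0, hτ⟩ := sqrt_mul_log_mul_log_le (N := n) (one_le_eta_diagIn hr hs h)
    (Real.sqrt_nonneg (1 - ε ^ 2)) hF1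
  have hmean := meanLogRatio_nonneg hr hr1 hs hs1 h
  rw [tensorPow_diagIn, tensorPow_diagIn]
  convert dMaxSmooth_le (prod_comp_nonneg hr n) (sum_prod_eq_one hr1 n) (prod_comp_nonneg hs n)
    (sum_prod_eq_one hs1 n) (subExp_tensorPow hr hr1 hs h hn)
    (fun q hq => prod_eq_mul_exp_centredLogRatio hr hs h hq) (by positivity) hε0 hε1 hτ using 2
  rw [add_div, mul_div_cancel_right₀ _ (Real.log_pos one_lt_two).ne', mul_div_assoc]

lemma le_dMaxSmooth_tensorPow_diagIn (hr : 0 ≤ r) (hr1 : ∑ i, r i = 1) (hs : 0 ≤ s)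
    (h : supp (diagIn V r) ≤ supp (diagIn W s)) {ε x : ℝ} (hε : 0 < ε) (hεx : ε < x)
    (hx1 : x < 1) {n : ℕ} (hn : 1 ≤ n) :
    ((n * (meanLogRatio V W r s / Real.log 2)
        - √n * (4 * √2) * Real.logb 2 (eta (diagIn V r) (diagIn W s)) * Real.logb 2 ((1 - x)⁻¹)
        - Real.logb 2 (1 / (x - ε)) : ℝ) : EReal)
      ≤ dMaxSmooth ε (tensorPow (diagIn V r) n) (tensorPow (diagIn W s) n) := by
  have hτ := (sqrt_mul_log_mul_log_le (N := n) (one_le_eta_diagIn hr hs h)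
    (hε.trans hεx).le hx1).2
  rw [tensorPow_diagIn, tensorPow_diagIn]
  convert le_dMaxSmooth (prod_comp_nonneg hr n) (sum_prod_eq_one hr1 n) (prod_comp_nonneg hs n)
    (subExp_tensorPow hr hr1 hs h hn)
    (fun q hq => prod_eq_mul_exp_centredLogRatio hr hs h hq) hε hεx hx1 hτ using 2
  rw [add_div, sub_div, mul_div_cancel_right₀ _ (Real.log_pos one_lt_two).ne', mul_div_assoc,
    one_div, Real.logb_inv _ (x - ε), sub_neg_eq_add, Real.log_div_log]

lemma one_div_mul_sqrt_mul (x y : ℝ) : 1 / x * (√x * y) = 1 / √x * y := by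
  rw [← mul_assoc, one_div_mul_eq_div, Real.sqrt_div_self']

lemma one_div_mul_le_add {u : EReal} {x D a : ℝ} (hx : 0 < x)
    (h : u ≤ ((x * D + √x * a : ℝ) : EReal)) :
    ((1 / x : ℝ) : EReal) * u ≤ D + ((1 / √x * a : ℝ) : EReal) := by
  have hinv : (0 : EReal) ≤ ((1 / x : ℝ) : EReal) := EReal.coe_nonneg.mpr (by positivity)
  refine (mul_le_mul_of_nonneg_left h hinv).trans_eq ?_
  rw [← EReal.coe_mul, ← EReal.coe_add, mul_add, one_div_mul_sqrt_mul, ← mul_assoc,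
    one_div_mul_cancel hx.ne', one_mul]

lemma sub_le_one_div_mul {u : EReal} {x D a b : ℝ} (hx : 0 < x)
    (h : ((x * D - √x * a - b : ℝ) : EReal) ≤ u) :
    D - ((1 / √x * a : ℝ) : EReal) - ((1 / x * b : ℝ) : EReal) ≤ ((1 / x : ℝ) : EReal) * u := by
  have hinv : (0 : EReal) ≤ ((1 / x : ℝ) : EReal) := EReal.coe_nonneg.mpr (by positivity)
  refine le_of_eq_of_le ?_ (mul_le_mul_of_nonneg_left h hinv)
  rw [← EReal.coe_mul, ← EReal.coe_sub, ← EReal.coe_sub, mul_sub, mul_sub,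
    one_div_mul_sqrt_mul, ← mul_assoc, one_div_mul_cancel hx.ne', one_mul]

variable {ρ σ : Matrix ι ι ℂ}

theorem one_div_mul_dMaxSmooth_tensorPow_le (hρ : IsState ρ) (hσ : IsState σ)
    (h : supp ρ ≤ supp σ) {ε : ℝ} (hε0 : 0 < ε) (hε1 : ε < 1) {n : ℕ} (hn : 1 ≤ n) :
    ((1 / (n : ℝ) : ℝ) : EReal) * dMaxSmooth ε (tensorPow ρ n) (tensorPow σ n)
      ≤ relEntropy ρ σ + ((1 / √(n : ℝ) * (4 * √2) * Real.logb 2 (eta ρ σ)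
          * Real.logb 2 ((1 - √(1 - ε ^ 2))⁻¹) : ℝ) : EReal) := by
  obtain ⟨V, r, rfl⟩ := exists_eq_diagIn hρ.1.1
  obtain ⟨W, s, rfl⟩ := exists_eq_diagIn hσ.1.1
  obtain ⟨hr, hr1⟩ := isState_diagIn_iff.mp hρ
  obtain ⟨hs, hs1⟩ := isState_diagIn_iff.mp hσ
  have hbound := dMaxSmooth_tensorPow_diagIn_le hr hr1 hs hs1 h hε0 hε1 hn
  rw [relEntropy_diagIn h]
  simp only [mul_assoc] at hbound ⊢
  exact one_div_mul_le_add (Nat.cast_pos.mpr hn) hbound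

theorem le_one_div_mul_dMaxSmooth_tensorPow (hρ : IsState ρ) (hσ : IsState σ)
    (h : supp ρ ≤ supp σ) {ε x : ℝ} (hε : 0 < ε) (hεx : ε < x) (hx1 : x < 1) {n : ℕ}
    (hn : 1 ≤ n) :
    relEntropy ρ σ
        - ((1 / √(n : ℝ) * (4 * √2) * Real.logb 2 (eta ρ σ) * Real.logb 2 ((1 - x)⁻¹) : ℝ) : EReal)
        - ((1 / (n : ℝ) * Real.logb 2 (1 / (x - ε)) : ℝ) : EReal)
      ≤ ((1 / (n : ℝ) : ℝ) : EReal) * dMaxSmooth ε (tensorPow ρ n) (tensorPow σ n) := by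
  obtain ⟨V, r, rfl⟩ := exists_eq_diagIn hρ.1.1
  obtain ⟨W, s, rfl⟩ := exists_eq_diagIn hσ.1.1
  obtain ⟨hr, hr1⟩ := isState_diagIn_iff.mp hρ
  obtain ⟨hs, -⟩ := isState_diagIn_iff.mp hσ
  have hbound := le_dMaxSmooth_tensorPow_diagIn hr hr1 hs h hε hεx hx1 hn
  rw [relEntropy_diagIn h]
  simp only [mul_assoc] at hbound ⊢
  exact sub_le_one_div_mul (Nat.cast_pos.mpr hn) hbound

end FiniteSize

lemma tendsto_of_le_add_one_div_sqrt {u : ℕ → EReal} {D A B C : ℝ}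
    (hupper : ∀ n : ℕ, 1 ≤ n → u n ≤ D + ((1 / √(n : ℝ) * A : ℝ) : EReal))
    (hlower : ∀ n : ℕ, 1 ≤ n →
      D - ((1 / √(n : ℝ) * B : ℝ) : EReal) - ((1 / (n : ℝ) * C : ℝ) : EReal) ≤ u n) :
    Tendsto u atTop (𝓝 (D : EReal)) := by
  have hinv : Tendsto (fun n : ℕ => 1 / (n : ℝ)) atTop (𝓝 0) :=
    tendsto_one_div_atTop_nhds_zero_nat
  have hinv_sqrt : Tendsto (fun n : ℕ => 1 / √(n : ℝ)) atTop (𝓝 0) := by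
    simp only [one_div]
    exact tendsto_inv_atTop_zero.comp (Real.tendsto_sqrt_atTop.comp tendsto_natCast_atTop_atTop)
  have hright : Tendsto (fun n : ℕ => ((D + 1 / √(n : ℝ) * A : ℝ) : EReal)) atTop (𝓝 D) :=
    EReal.tendsto_coe.mpr (by simpa only [zero_mul, add_zero] using
      (hinv_sqrt.mul_const A).const_add D)
  have hleft : Tendsto (fun n : ℕ => ((D - 1 / √(n : ℝ) * B - 1 / (n : ℝ) * C : ℝ) : EReal))
      atTop (𝓝 D) :=
    EReal.tendsto_coe.mpr (by simpa only [zero_mul, sub_zero] using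
      ((hinv_sqrt.mul_const B).const_sub D).sub (hinv.mul_const C))
  refine tendsto_of_tendsto_of_tendsto_of_le_of_le' hleft hright ?_ ?_
  · filter_upwards [eventually_ge_atTop 1] with n hn
    simpa only [EReal.coe_sub] using hlower n hn
  · filter_upwards [eventually_ge_atTop 1] with n hn
    simpa only [EReal.coe_add] using hupper n hn

end QAEP

end

theorem mainTheorem3 {ι : Type*} [Fintype ι] [DecidableEq ι] (ρ σ : Matrix ι ι ℂ)
    (hρ : QAEP.IsState ρ) (hσ : QAEP.IsState σ) (hsupp : QAEP.supp ρ ≤ QAEP.supp σ) :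
    (∀ ε ε' : ℝ, 0 < ε → ε < ε' → ε' < 1 → ∀ n : ℕ, 1 ≤ n →
      ((1 / (n : ℝ) : ℝ) : EReal)
          * QAEP.dMaxSmooth ε (QAEP.tensorPow ρ n) (QAEP.tensorPow σ n)
        ≤ QAEP.relEntropy ρ σ
          + ((1 / √(n : ℝ) * (4 * √2) * Real.logb 2 (QAEP.eta ρ σ)
              * Real.logb 2 ((1 - √(1 - ε ^ 2))⁻¹) : ℝ) : EReal)
      ∧ QAEP.relEntropy ρ σ
          - ((1 / √(n : ℝ) * (4 * √2) * Real.logb 2 (QAEP.eta ρ σ)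
              * Real.logb 2 ((1 - ε')⁻¹) : ℝ) : EReal)
          - ((1 / (n : ℝ) * Real.logb 2 (1 / (ε' - ε)) : ℝ) : EReal)
        ≤ ((1 / (n : ℝ) : ℝ) : EReal)
          * QAEP.dMaxSmooth ε (QAEP.tensorPow ρ n) (QAEP.tensorPow σ n))
    ∧ ∀ ε : ℝ, 0 < ε → ε < 1 →
      Tendsto (fun n : ℕ => ((1 / (n : ℝ) : ℝ) : EReal)
          * QAEP.dMaxSmooth ε (QAEP.tensorPow ρ n) (QAEP.tensorPow σ n))
        atTop (𝓝 (QAEP.relEntropy ρ σ)) := by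
  refine ⟨fun ε ε' hε hεε' hε' n hn =>
    ⟨QAEP.one_div_mul_dMaxSmooth_tensorPow_le hρ hσ hsupp hε (hεε'.trans hε') hn,
      QAEP.le_one_div_mul_dMaxSmooth_tensorPow hρ hσ hsupp hε hεε' hε' hn⟩, fun ε hε hε1 => ?_⟩
  obtain ⟨ε', hεε', hε'⟩ := exists_between hε1
  have hupper := fun (n : ℕ) (hn : 1 ≤ n) =>
    QAEP.one_div_mul_dMaxSmooth_tensorPow_le hρ hσ hsupp hε hε1 hn
  have hlower := fun (n : ℕ) (hn : 1 ≤ n) =>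
    QAEP.le_one_div_mul_dMaxSmooth_tensorPow hρ hσ hsupp hε hεε' hε' hn
  rw [QAEP.relEntropy, if_pos hsupp] at hupper hlower ⊢
  simp only [mul_assoc (1 / √_)] at hupper hlower
  exact QAEP.tendsto_of_le_add_one_div_sqrt hupper hlower
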